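/- Let $\mathbb S^1\approx[0,2\pi)$ be the circle with periodic boundary conditions, let $d\sigma=\frac{dx}{2\pi}$ be its uniform probability measure, and let $\|f\|_r=\left(\int_{\mathbb S^1}|f|^r\,d\sigma\right)^{1/r}$. All functions are real-valued. Let $2<p<q$ and define \[ \lambda_1=\inf\left\{\frac{\|v'\|_p^2}{\|v\|_p^2}\,:\,v\in W^{1,p}(\mathbb S^1)\setminus\{0\},\ \int_{\mathbb S^1}v\,d\sigma=0\right\},\qquad \mu(\lambda)=\inf_{u\in W^{1,p}(\mathbb S^1)\setminus\{0\}}\frac{\|u'\|_p^2+\lambda\,\|u\|_p^2}{\|u\|_q^2}\quad(\lambda\ge0). \] The function $\lambda\mapsto\mu(\lambda)$ is a bijection from $[0,+\infty)$ onto $[0,+\infty)$; let $\mu\mapsto\lambda(\mu)$ denote its inverse. Let $V\in L^{q/(q-p)}(\mathbb S^1)$. For every $u\in W^{1,p}(\mathbb S^1)$, $u\in L^q(\mathbb S^1)$ and $V|u|^p$ is integrable, and the following Keller-Lieb-Thirring estimates hold. (1) For every $u\in W^{1,p}(\mathbb S^1)$, \[ \|u'\|_p^2-\|u\|_q^{2-p}\int_{\mathbb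 S^1}V\,|u|^p\,d\sigma\ \ge\ -\,\lambda\left(\|V\|_{\frac q{q-p}}\right)\|u\|_p^2 \] (for $u=0$ the second term is understood as $0$); in particular $\|u'\|_p^2-\int_{\mathbb S^1}V|u|^p\,d\sigma\ge-\lambda(\|V\|_{q/(q-p)})\,\|u\|_p^2$ whenever $\|u\|_q=1$. Moreover, if $\|V\|_{q/(q-p)}\le\frac{\lambda_1}{q-p}$, then $\lambda(\|V\|_{q/(q-p)})=\|V\|_{q/(q-p)}$, and in that case equality in the estimate is realized by some $u\not\equiv0$ if and only if $V$ is (a.e. equal to) a nonnegative constant. (2) For every $u\in W^{1,p}(\mathbb S^1)$, writing $a_+=\max(a,0)$, \[ \|u'\|_p^2-\left(\int_{\mathbb S^1}V\,|u|^p\,d\sigma\right)_+^{2/p}\ \ge\ -\,\lambda\left(\|V\|_{\frac q{q-p}}^{2/p}\right)\|u\|_p^2 . \] Moreover, if $\|V\|_{q/(q-p)}^{2/p}\le\frac{\lambda_1}{q-p}$, then $\lambda(\|V\|_{q/(q-p)}^{2/p})=\|V\|_{q/(q-p)}^{2/p}$, and in that case equality in the estimate is realized by some $u\not\equiv0$ if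 and only if $V$ is (a.e. equal to) a nonnegative constant. -/

import Mathlib

open MeasureTheory
open scoped ContDiff

noncomputable section

namespace KLT

instance fact_two_pi_pos : Fact (0 < 2 * Real.pi) := ⟨Real.two_pi_pos⟩

/-- The unit circle, identified with `[0, 2π)` with periodic boundary conditions. -/
abbrev Circ : Type := AddCircle (2 * Real.pi)

/-- The uniform probability measure `dσ = dx / (2π)` on the circle. -/
abbrev sigma : Measure Circ := AddCircle.haarAddCircle

/-- The norm `‖f‖_r = (∫ |f|^r dσ)^(1/r)`. -/
def nrm (r : ℝ) (f : Circ → ℝ) : ℝ :=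
  (∫ x, |f x| ^ r ∂sigma) ^ (1 / r)

/-- `du` is a weak derivative of `u` on the circle: `∫ u φ' dσ = - ∫ du φ dσ` for every smooth
function `φ` on the circle, with derivative `φ'`. -/
def IsWeakDeriv (u du : Circ → ℝ) : Prop :=
  ∀ φ dφ : Circ → ℝ, ContDiff ℝ ∞ (fun x : ℝ => φ (x : Circ)) →
    (∀ x : ℝ, HasDerivAt (fun y : ℝ => φ (y : Circ)) (dφ (x : Circ)) x) →
    ∫ x, u x * dφ x ∂sigma = - ∫ x, du x * φ x ∂sigma

/-- `u` belongs to the Sobolev space `W^{1,p}` of the circle, and its weak derivative (which is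
unique up to null sets) is `du`. -/
structure IsW1p (p : ℝ) (u du : Circ → ℝ) : Prop where
  memLp : MemLp u (ENNReal.ofReal p) sigma
  memLp_deriv : MemLp du (ENNReal.ofReal p) sigma
  weakDeriv : IsWeakDeriv u du

/-- `u` is not the zero element of `W^{1,p}`. -/
def NonZero (u : Circ → ℝ) : Prop := ¬ (u =ᵐ[sigma] fun _ => 0)

/-- `λ₁`, the infimum of `‖v'‖_p² / ‖v‖_p²` over all `v ≠ 0` in `W^{1,p}` with `∫ v dσ = 0`. -/
def lambda1 (p : ℝ) : ℝ :=
  sInf {t : ℝ | ∃ v dv : Circ → ℝ, IsW1p p v dv ∧ NonZero v ∧ ∫ x, v x ∂sigma = 0 ∧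
    t = nrm p dv ^ 2 / nrm p v ^ 2}

/-- `μ(l)`, the infimum of `(‖u'‖_p² + l ‖u‖_p²) / ‖u‖_q²` over all `u ≠ 0` in `W^{1,p}`. -/
def mu (p q l : ℝ) : ℝ :=
  sInf {t : ℝ | ∃ u du : Circ → ℝ, IsW1p p u du ∧ NonZero u ∧
    t = (nrm p du ^ 2 + l * nrm p u ^ 2) / nrm q u ^ 2}

/-- `m ↦ λ(m)`, the inverse of the function `l ↦ μ(l)` on `[0, ∞)`. -/
def lam (p q m : ℝ) : ℝ := Function.invFunOn (mu p q) (Set.Ici 0) m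

/-- The potential energy `∫ V |u|^p dσ`. -/
def pot (p : ℝ) (V u : Circ → ℝ) : ℝ := ∫ x, V x * |u x| ^ p ∂sigma

end KLT

end

/-!
The estimates follow from Hölder's inequality and from the interpolation inequality
`μ(l) ‖u‖_q² ≤ ‖u'‖_p² + l ‖u‖_p²`, which holds by the definition of `μ`. The function `μ` is
nondecreasing, `1`-Lipschitz, concave as an infimum of affine functions, and unbounded by a
Gagliardo-Nirenberg argument; hence it is a bijection of `[0, ∞)` (`KLT.mu_bijOn`).

The sharp part is that `μ(l) = l`, with only constants as optimal functions, as soon as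
`(q - p) l ≤ λ₁` (`KLT.rigidity`). An optimal function exists (`KLT.exists_minimizer`), and it may
be replaced by its absolute value. A nonnegative optimal function `f` solves an autonomous equation
`W' = α f^(p-1) - β f^(q-1)`, where `W = |f'|^(p-2) f'` and
`α = l ‖f'‖_p^(p-2) ‖f‖_p^(2-p)` (`KLT.exists_isSolution`); conservation of energy and Gronwall's
inequality show that it is positive (`KLT.IsSolution.eq_zero`). Testing the equation with
`f^(2-p) (W' + (q+1-p) |f'|^p / f)`, the term of exponent `q` integrates to zero and
(`KLT.IsSolution.integral_identity`)
`∫ f^(2-p) W'² + C ∫ f^(-p) |f'|^(2p) = α (q - p) ∫ |f'|^p` with `C > 0`.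
On the other hand `∫ |f'|^p = - ∫ (f - ∫ f) W'`, so that the inequalities of Cauchy-Schwarz, Hölder
and Poincaré give (`KLT.IsSolution.poincare`)
`λ₁ (∫ |f'|^p)² ≤ ‖f'‖_p² ‖f‖_p^(p-2) ∫ f^(2-p) W'²`.
Together these yield `λ₁ < (q - p) l` unless `f' = 0`. No separate discussion of the borderline case
`(q - p) l = λ₁` is needed, since the second term of the identity is positive.

If equality holds in one of the estimates, then `u` is optimal, hence constant, and `V` realizes
equality in Hölder's inequality against a constant, hence is constant.
-/

namespace KLT

/-! ### The norms -/

lemma nrm_nonneg (r : ℝ) (f : Circ → ℝ) : 0 ≤ nrm r f :=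
  Real.rpow_nonneg (integral_nonneg fun _ => Real.rpow_nonneg (abs_nonneg _) _) _

lemma nrm_rpow {r : ℝ} (hr : 0 < r) (f : Circ → ℝ) : nrm r f ^ r = ∫ x, |f x| ^ r ∂sigma := by
  have h : 0 ≤ ∫ x, |f x| ^ r ∂sigma :=
    integral_nonneg fun _ => Real.rpow_nonneg (abs_nonneg _) _
  rw [nrm, ← Real.rpow_mul h, one_div, inv_mul_cancel₀ hr.ne', Real.rpow_one]

lemma nrm_congr {r : ℝ} {f g : Circ → ℝ} (h : f =ᵐ[sigma] g) : nrm r f = nrm r g := by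
  unfold nrm
  congr 1
  apply integral_congr_ae
  filter_upwards [h] with x hx
  rw [hx]

lemma nrm_congr_abs {r : ℝ} {f g : Circ → ℝ} (h : ∀ᵐ x ∂sigma, |f x| = |g x|) :
    nrm r f = nrm r g := by
  unfold nrm
  congr 1
  apply integral_congr_ae
  filter_upwards [h] with x hx
  rw [hx]

lemma nrm_const {r : ℝ} (hr : 0 < r) (c : ℝ) : nrm r (fun _ => c) = |c| := by
  rw [nrm, integral_const]
  simp only [probReal_univ, one_smul]
  rw [← Real.rpow_mul (abs_nonneg c), one_div, mul_inv_cancel₀ hr.ne', Real.rpow_one]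

lemma nrm_eq_toReal {r : ℝ} (hr : 0 < r) {f : Circ → ℝ} (hf : MemLp f (ENNReal.ofReal r) sigma) :
    nrm r f = (eLpNorm f (ENNReal.ofReal r) sigma).toReal := by
  rw [hf.eLpNorm_eq_integral_rpow_norm (by simpa using hr) ENNReal.ofReal_ne_top,
    ENNReal.toReal_ofReal hr.le, ENNReal.toReal_ofReal, nrm, one_div]
  · rfl
  · exact Real.rpow_nonneg (integral_nonneg fun _ => Real.rpow_nonneg (norm_nonneg _) _) _

lemma integrable_rpow_abs {r : ℝ} (hr : 0 < r) {f : Circ → ℝ}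
    (hf : MemLp f (ENNReal.ofReal r) sigma) : Integrable (fun x => |f x| ^ r) sigma := by
  have := hf.integrable_norm_rpow (by simpa using hr) ENNReal.ofReal_ne_top
  rwa [ENNReal.toReal_ofReal hr.le] at this

lemma nrm_add_le {r : ℝ} (hr : 1 ≤ r) {f g : Circ → ℝ} (hf : MemLp f (ENNReal.ofReal r) sigma)
    (hg : MemLp g (ENNReal.ofReal r) sigma) :
    nrm r (fun x => f x + g x) ≤ nrm r f + nrm r g := by
  have h0 : 0 < r := by linarith
  have hfg : MemLp (fun x => f x + g x) (ENNReal.ofReal r) sigma := hf.add hg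
  rw [nrm_eq_toReal h0 hf, nrm_eq_toReal h0 hg, nrm_eq_toReal h0 hfg,
    ← ENNReal.toReal_add hf.2.ne hg.2.ne]
  apply ENNReal.toReal_mono (ENNReal.add_lt_top.2 ⟨hf.2, hg.2⟩).ne
  exact eLpNorm_add_le hf.1 hg.1 (by simpa using hr)

lemma nrm_smul {r : ℝ} (hr : 0 < r) (c : ℝ) (f : Circ → ℝ) :
    nrm r (fun x => c * f x) = |c| * nrm r f := by
  unfold nrm
  have : ∀ x, |c * f x| ^ r = |c| ^ r * |f x| ^ r := fun x => by
    rw [abs_mul, Real.mul_rpow (abs_nonneg _) (abs_nonneg _)]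
  simp_rw [this]
  rw [integral_const_mul, Real.mul_rpow (Real.rpow_nonneg (abs_nonneg _) _)
    (integral_nonneg fun _ => Real.rpow_nonneg (abs_nonneg _) _),
    ← Real.rpow_mul (abs_nonneg c), mul_one_div_cancel hr.ne', Real.rpow_one]

lemma nrm_mono_abs {r : ℝ} (hr : 0 < r) {f g : Circ → ℝ}
    (hg : MemLp g (ENNReal.ofReal r) sigma) (h : ∀ᵐ x ∂sigma, |f x| ≤ |g x|) :
    nrm r f ≤ nrm r g := by
  unfold nrm
  apply Real.rpow_le_rpow (integral_nonneg fun _ => Real.rpow_nonneg (abs_nonneg _) _) _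
    (by positivity)
  apply integral_mono_of_nonneg (.of_forall fun _ => Real.rpow_nonneg (abs_nonneg _) _)
    (integrable_rpow_abs hr hg)
  filter_upwards [h] with x hx
  exact Real.rpow_le_rpow (abs_nonneg _) hx hr.le

lemma nrm_le_of_bound {r : ℝ} (hr : 0 < r) {f : Circ → ℝ} {C : ℝ} (hC : 0 ≤ C)
    (h : ∀ᵐ x ∂sigma, |f x| ≤ C) : nrm r f ≤ C := by
  have := nrm_mono_abs (f := f) hr (memLp_const C (μ := sigma) (p := ENNReal.ofReal r))
    (by simpa [abs_of_nonneg hC] using h)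
  rwa [nrm_const hr, abs_of_nonneg hC] at this

lemma nrm_mono_exponent {r s : ℝ} (hr : 0 < r) (hrs : r ≤ s) {f : Circ → ℝ}
    (hf : MemLp f (ENNReal.ofReal s) sigma) : nrm r f ≤ nrm s f := by
  have hfr : MemLp f (ENNReal.ofReal r) sigma := hf.mono_exponent (ENNReal.ofReal_le_ofReal hrs)
  rw [nrm_eq_toReal hr hfr, nrm_eq_toReal (hr.trans_le hrs) hf]
  exact ENNReal.toReal_mono hf.2.ne
    (eLpNorm_le_eLpNorm_of_exponent_le (ENNReal.ofReal_le_ofReal hrs) hf.1)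

lemma nrm_eq_zero_iff {r : ℝ} (hr : 0 < r) {f : Circ → ℝ}
    (hf : MemLp f (ENNReal.ofReal r) sigma) : nrm r f = 0 ↔ f =ᵐ[sigma] fun _ => 0 := by
  rw [nrm_eq_toReal hr hf, ENNReal.toReal_eq_zero_iff, or_iff_left hf.2.ne,
    eLpNorm_eq_zero_iff hf.1 (by simpa using hr)]
  rfl

lemma nrm_pos {r : ℝ} (hr : 0 < r) {f : Circ → ℝ}
    (hf : MemLp f (ENNReal.ofReal r) sigma) (h : NonZero f) : 0 < nrm r f :=
  (nrm_nonneg r f).lt_of_ne' fun h0 => h ((nrm_eq_zero_iff hr hf).1 h0)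

/-- Hölder's inequality. -/
lemma integral_abs_mul_le {r s : ℝ} (hrs : r.HolderConjugate s) {f g : Circ → ℝ}
    (hf : MemLp f (ENNReal.ofReal r) sigma) (hg : MemLp g (ENNReal.ofReal s) sigma) :
    ∫ x, |f x| * |g x| ∂sigma ≤ nrm r f * nrm s g :=
  integral_mul_norm_le_Lp_mul_Lq hrs hf hg

/-- The norm of a power. -/
lemma nrm_rpow_abs {r s : ℝ} (hr : 0 < r) (hs : 0 < s) (f : Circ → ℝ) :
    nrm r (fun x => |f x| ^ s) = nrm (r * s) f ^ s := by
  have h0 : 0 ≤ ∫ x, |f x| ^ (r * s) ∂sigma :=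
    integral_nonneg fun _ => Real.rpow_nonneg (abs_nonneg _) _
  have : ∀ x, |(|f x| ^ s)| ^ r = |f x| ^ (r * s) := fun x => by
    rw [abs_of_nonneg (Real.rpow_nonneg (abs_nonneg _) _), ← Real.rpow_mul (abs_nonneg _), mul_comm]
  unfold nrm
  simp_rw [this]
  rw [← Real.rpow_mul h0]
  congr 1
  field_simp

lemma memLp_rpow_abs {r s : ℝ} (hr : 0 < r) (hs : 0 < s) {f : Circ → ℝ}
    (hf : MemLp f (ENNReal.ofReal (r * s)) sigma) :
    MemLp (fun x => |f x| ^ s) (ENNReal.ofReal r) sigma := by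
  have h1 : AEStronglyMeasurable (fun x => |f x| ^ s) sigma :=
    (hf.1.aemeasurable.abs.pow_const s).aestronglyMeasurable
  rw [← integrable_norm_rpow_iff h1 (by simpa using hr) ENNReal.ofReal_ne_top,
    ENNReal.toReal_ofReal hr.le]
  refine (integrable_rpow_abs (by positivity) hf).congr (.of_forall fun x => ?_)
  simp only [Real.norm_eq_abs]
  rw [abs_of_nonneg (Real.rpow_nonneg (abs_nonneg _) _), ← Real.rpow_mul (abs_nonneg _), mul_comm]

/-- On a probability space, equality in Hölder's inequality against the constant `1` forces the
function to be constant. -/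
lemma ae_eq_const_of_integral_eq_nrm {r : ℝ} (hr : 1 < r) {V : Circ → ℝ}
    (hV : MemLp V (ENNReal.ofReal r) sigma) (h : ∫ x, V x ∂sigma = nrm r V) :
    V =ᵐ[sigma] fun _ => nrm r V := by
  have h0 : 0 < r := by linarith
  rcases (nrm_nonneg r V).eq_or_lt with hm | hm
  · rw [← hm]
    exact (nrm_eq_zero_iff h0 hV).1 hm.symm
  set m := nrm r V with hmdef
  -- the gap in Bernoulli's inequality for `(|V| / m) ^ r` has zero integral
  have key : ∀ x, 0 ≤ (|V x| / m) ^ r - (1 + r * (|V x| / m - 1)) ∧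
      ((|V x| / m) ^ r - (1 + r * (|V x| / m - 1)) = 0 → |V x| = m) := by
    intro x
    have hs : -1 ≤ |V x| / m - 1 := by linarith [div_nonneg (abs_nonneg (V x)) hm.le]
    have h1 := one_add_mul_self_le_rpow_one_add hs hr.le
    rw [add_sub_cancel] at h1
    refine ⟨by linarith, fun h2 => ?_⟩
    by_contra h3
    have h4 : |V x| / m - 1 ≠ 0 := fun h5 => h3 (by field_simp at h5; linarith)
    have h5 := one_add_mul_self_lt_rpow_one_add hs h4 hr
    rw [add_sub_cancel] at h5
    linarith
  have hVint : Integrable V sigma := hV.integrable (by simpa using hr.le)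
  have i1 : Integrable (fun x => (|V x| / m) ^ r) sigma := by
    simp_rw [Real.div_rpow (abs_nonneg _) hm.le]
    exact (integrable_rpow_abs h0 hV).div_const _
  have i0 : Integrable (fun x => |V x| / m - 1) sigma :=
    (hVint.abs.div_const m).sub (integrable_const 1)
  have i2 : Integrable (fun x => 1 + r * (|V x| / m - 1)) sigma :=
    (integrable_const 1).add (i0.const_mul r)
  have e1 : ∫ x, (|V x| / m) ^ r ∂sigma = 1 := by
    simp_rw [Real.div_rpow (abs_nonneg _) hm.le]
    rw [integral_div, ← nrm_rpow h0, ← hmdef, div_self (by positivity)]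
  have e2 : ∫ x, (1 + r * (|V x| / m - 1)) ∂sigma = 1 + r * ((∫ x, |V x| ∂sigma) / m - 1) := by
    rw [integral_add (integrable_const 1) (i0.const_mul r), integral_const_mul,
      integral_sub (hVint.abs.div_const m) (integrable_const 1), integral_div]
    simp
  have hle : m ≤ ∫ x, |V x| ∂sigma := by
    rw [← h]; exact integral_mono hVint hVint.abs fun x => le_abs_self _
  have hge : ∫ x, ((|V x| / m) ^ r - (1 + r * (|V x| / m - 1))) ∂sigma =
      r * (1 - (∫ x, |V x| ∂sigma) / m) := by
    rw [integral_sub i1 i2, e1, e2]; ring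
  have hnn := integral_nonneg (μ := sigma)
    (f := fun x => (|V x| / m) ^ r - (1 + r * (|V x| / m - 1))) (fun x => (key x).1)
  have hle1 : 1 ≤ (∫ x, |V x| ∂sigma) / m := by rwa [le_div_iff₀ hm, one_mul]
  have hz : ∫ x, ((|V x| / m) ^ r - (1 + r * (|V x| / m - 1))) ∂sigma = 0 :=
    le_antisymm (by rw [hge]; nlinarith) hnn
  have hae := (integral_eq_zero_iff_of_nonneg (fun x => (key x).1) (i1.sub i2)).1 hz
  have habs : ∀ᵐ x ∂sigma, |V x| = m := by
    filter_upwards [hae] with x hx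
    exact (key x).2 hx
  have hz2 : ∫ x, (m - V x) ∂sigma = 0 := by
    rw [integral_sub (integrable_const m) hVint, h]; simp
  have := (integral_eq_zero_iff_of_nonneg_ae (μ := sigma) (f := fun x => m - V x) (by
    filter_upwards [habs] with x hx
    have := le_abs_self (V x)
    simp only [Pi.zero_apply]
    linarith) ((integrable_const m).sub hVint)).1 hz2
  filter_upwards [this] with x hx
  simp only [Pi.zero_apply] at hx
  linarith

/-! ### The circle and its universal cover -/

lemma integral_sigma (f : Circ → ℝ) (a : ℝ) :
    ∫ x, f x ∂sigma = (2 * Real.pi)⁻¹ * ∫ t in a..a + 2 * Real.pi, f t := by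
  rw [sigma, AddCircle.integral_haarAddCircle, AddCircle.intervalIntegral_preimage, smul_eq_mul]

lemma ae_sigma_iff_ae_volume {P : Circ → Prop} :
    (∀ᵐ x ∂sigma, P x) ↔ ∀ᵐ x ∂(volume : Measure Circ), P x := by
  rw [AddCircle.volume_eq_smul_haarAddCircle, Measure.ae_ennreal_smul_measure_iff]
  simpa using Real.pi_pos

lemma ae_lift {P : Circ → Prop} (h : ∀ᵐ x ∂sigma, P x) : ∀ᵐ t : ℝ, P (t : Circ) := by
  rw [ae_sigma_iff_ae_volume] at h
  have h1 : ∀ n : ℤ, ∀ᵐ t : ℝ, t ∈ Set.Ioc (n • (2 * Real.pi)) ((n + 1) • (2 * Real.pi)) →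
      P (t : Circ) := by
    intro n
    rw [← ae_restrict_iff' measurableSet_Ioc, add_smul, one_smul]
    exact (AddCircle.measurePreserving_mk (2 * Real.pi) _).quasiMeasurePreserving.ae h
  filter_upwards [ae_all_iff.2 h1] with t ht
  have : t ∈ ⋃ n : ℤ, Set.Ioc (n • (2 * Real.pi)) ((n + 1) • (2 * Real.pi)) := by
    rw [iUnion_Ioc_zsmul Real.two_pi_pos]; trivial
  obtain ⟨n, hn⟩ := Set.mem_iUnion.1 this
  exact ht n hn

lemma ae_descend {P : Circ → Prop} (h : ∀ᵐ t : ℝ, P (t : Circ)) : ∀ᵐ x ∂sigma, P x := by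
  rw [ae_sigma_iff_ae_volume]
  have h2 := (AddCircle.measurePreserving_equivIoc (2 * Real.pi) (a := 0)).quasiMeasurePreserving
  have h3 := (ae_restrict_iff_subtype (μ := volume) (s := Set.Ioc (0 : ℝ) (0 + 2 * Real.pi))
    (p := fun t : ℝ => P (t : Circ)) measurableSet_Ioc).1 (ae_restrict_of_ae h)
  filter_upwards [h2.ae h3] with x hx
  have := (AddCircle.equivIoc (2 * Real.pi) 0).symm_apply_apply x
  rw [← this]
  exact hx

lemma intervalIntegrable_lift {f : Circ → ℝ} (hf : Integrable f sigma) (a b : ℝ) :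
    IntervalIntegrable (fun t : ℝ => f t) volume a b := by
  have h1 : Integrable f (volume : Measure Circ) := by
    rw [AddCircle.volume_eq_smul_haarAddCircle]
    exact hf.smul_measure ENNReal.ofReal_ne_top
  have h2 : IntervalIntegrable (fun t : ℝ => f t) volume 0 (0 + 2 * Real.pi) := by
    rw [intervalIntegrable_iff_integrableOn_Ioc_of_le (by linarith [Real.two_pi_pos])]
    exact (AddCircle.measurePreserving_mk (2 * Real.pi) 0).integrable_comp_of_integrable h1
  have hper : Function.Periodic (fun t : ℝ => f t) (2 * Real.pi) := fun t => by
    simp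
  exact hper.intervalIntegrable Real.two_pi_pos.ne' h2 a b

lemma continuous_of_lift {U : Circ → ℝ} (h : Continuous fun t : ℝ => U t) : Continuous U :=
  continuous_coinduced_dom.2 h

lemma continuous_of_hasDerivAt_lift {φ dφ : Circ → ℝ} (hφ : ContDiff ℝ ∞ fun x : ℝ => φ x)
    (hd : ∀ x : ℝ, HasDerivAt (fun y : ℝ => φ y) (dφ x) x) : Continuous dφ := by
  apply continuous_of_lift
  have : (fun t : ℝ => dφ t) = deriv fun t : ℝ => φ t := by
    ext t; rw [(hd t).deriv]
  rw [this]
  exact hφ.continuous_deriv (by simp)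

/-! ### Primitives -/

/-- `U` is a primitive of the integrable function `g` on the circle: the increments of `U` along
arcs are the integrals of `g` (arcs being described in the universal cover `ℝ`). -/
structure IsPrimitive (U g : Circ → ℝ) : Prop where
  integrable : Integrable g sigma
  sub_eq : ∀ x y : ℝ, U y - U x = ∫ t in x..y, g t

lemma IsPrimitive.continuous {U g : Circ → ℝ} (h : IsPrimitive U g) : Continuous U := by
  apply continuous_of_lift
  have h1 : (fun t : ℝ => U t) = fun t => U ((0 : ℝ) : Circ) + ∫ s in (0 : ℝ)..t, g s := by
    ext t
    rw [← h.sub_eq]; ring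
  rw [h1]
  exact continuous_const.add
    (intervalIntegral.continuous_primitive (intervalIntegrable_lift h.integrable) 0)

lemma IsPrimitive.absolutelyContinuous {U g : Circ → ℝ} (h : IsPrimitive U g) (a b : ℝ) :
    AbsolutelyContinuousOnInterval (fun t : ℝ => U t) a b := by
  have h1 : (fun t : ℝ => U t) = fun t => (∫ s in a..t, g s) - (-U (a : Circ)) := by
    ext t
    rw [← h.sub_eq]; ring
  rw [h1]
  exact ((intervalIntegrable_lift h.integrable a b).absolutelyContinuousOnInterval_intervalIntegral
    (Set.left_mem_uIcc)).sub
    ((LipschitzWith.const (-U (a : Circ))).lipschitzOnWith.absolutelyContinuousOnInterval)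

/-- Lebesgue's differentiation theorem for primitives. -/
lemma IsPrimitive.ae_hasDerivAt {U g : Circ → ℝ} (h : IsPrimitive U g) :
    ∀ᵐ x : ℝ, HasDerivAt (fun t : ℝ => U t) (g x) x := by
  have hl : LocallyIntegrable (fun t : ℝ => g t) volume := by
    rw [locallyIntegrable_iff]
    intro K hK
    obtain ⟨R, hR⟩ := hK.isBounded.subset_closedBall 0
    rw [Real.closedBall_eq_Icc] at hR
    refine IntegrableOn.mono_set ?_ hR
    rw [integrableOn_Icc_iff_integrableOn_Ioc]
    exact (intervalIntegrable_lift h.integrable _ _).1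
  filter_upwards [LocallyIntegrable.ae_hasDerivAt_integral hl] with x hx
  have h1 : (fun t : ℝ => U t) = fun t => U ((0 : ℝ) : Circ) + ∫ s in (0 : ℝ)..t, g s := by
    ext t
    rw [← h.sub_eq]; ring
  rw [h1]
  exact (hx 0).const_add _

lemma IsPrimitive.integral_eq_zero {U g : Circ → ℝ} (h : IsPrimitive U g) :
    ∫ x, g x ∂sigma = 0 := by
  rw [integral_sigma g 0, ← h.sub_eq, AddCircle.coe_add_period, sub_self, mul_zero]

/-- Integrable functions with mean zero have a primitive, with a prescribed value at `0`. -/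
lemma exists_isPrimitive {g : Circ → ℝ} (hg : Integrable g sigma) (h0 : ∫ x, g x ∂sigma = 0)
    (c : ℝ) : ∃ U : Circ → ℝ, IsPrimitive U g ∧ U 0 = c := by
  have hi := intervalIntegrable_lift hg
  have h1 : ∀ a : ℝ, ∫ t in a..a + 2 * Real.pi, g t = 0 := fun a => by
    have := integral_sigma g a
    rw [h0] at this
    rcases mul_eq_zero.1 this.symm with h | h
    · exact absurd h (inv_ne_zero Real.two_pi_pos.ne')
    · exact h
  have hper : Function.Periodic (fun x : ℝ => c + ∫ t in (0 : ℝ)..x, g t) (2 * Real.pi) := by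
    intro x
    simp only
    rw [← intervalIntegral.integral_add_adjacent_intervals (hi 0 x) (hi x _), h1, add_zero]
  refine ⟨hper.lift, ⟨hg, fun x y => ?_⟩, ?_⟩
  · rw [hper.lift_coe, hper.lift_coe,
      ← intervalIntegral.integral_add_adjacent_intervals (hi 0 x) (hi x y)]
    ring
  · rw [← QuotientAddGroup.mk_zero, hper.lift_coe]
    simp

/-- Integration by parts: a primitive of `g` has weak derivative `g`. -/
lemma IsPrimitive.isWeakDeriv {U g : Circ → ℝ} (h : IsPrimitive U g) : IsWeakDeriv U g := by
  intro φ dφ hφ hd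
  have hac : AbsolutelyContinuousOnInterval (fun t : ℝ => φ t) 0 (0 + 2 * Real.pi) :=
    (hφ.of_le (by simp)).contDiffOn.absolutelyContinuousOnInterval
  have key := (h.absolutelyContinuous 0 (0 + 2 * Real.pi)).integral_mul_deriv_eq_deriv_mul hac
  have e1 : ∫ t in (0 : ℝ)..0 + 2 * Real.pi, U t * deriv (fun t : ℝ => φ t) t =
      ∫ t in (0 : ℝ)..0 + 2 * Real.pi, U t * dφ t := by
    apply intervalIntegral.integral_congr
    intro t _
    simp only [(hd t).deriv]
  have e2 : ∫ t in (0 : ℝ)..0 + 2 * Real.pi, deriv (fun t : ℝ => U t) t * φ t =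
      ∫ t in (0 : ℝ)..0 + 2 * Real.pi, g t * φ t := by
    apply intervalIntegral.integral_congr_ae
    filter_upwards [h.ae_hasDerivAt] with t ht _
    rw [ht.deriv]
  rw [e1, e2] at key
  rw [integral_sigma _ 0, integral_sigma _ 0, key, AddCircle.coe_add_period]
  ring

lemma IsWeakDeriv.add {u du v dv : Circ → ℝ} (hu : IsWeakDeriv u du) (hv : IsWeakDeriv v dv)
    (iu : Integrable u sigma) (idu : Integrable du sigma) (iv : Integrable v sigma)
    (idv : Integrable dv sigma) :
    IsWeakDeriv (fun x => u x + v x) (fun x => du x + dv x) := by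
  intro φ dφ hφ hd
  have cφ : Continuous φ := continuous_of_lift hφ.continuous
  have cdφ := continuous_of_hasDerivAt_lift hφ hd
  have hb : ∀ {f ψ : Circ → ℝ}, Integrable f sigma → Continuous ψ →
      Integrable (fun x => f x * ψ x) sigma := by
    intro f ψ hf hψ
    obtain ⟨C, hC⟩ := isCompact_univ.exists_bound_of_continuousOn hψ.continuousOn
    exact hf.mul_bdd hψ.aestronglyMeasurable (.of_forall fun x => hC x trivial)
  simp_rw [add_mul]
  rw [integral_add (hb iu cdφ) (hb iv cdφ), integral_add (hb idu cφ) (hb idv cφ),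
    hu φ dφ hφ hd, hv φ dφ hφ hd]
  ring

lemma IsWeakDeriv.const_mul {u du : Circ → ℝ} (hu : IsWeakDeriv u du) (c : ℝ) :
    IsWeakDeriv (fun x => c * u x) (fun x => c * du x) := by
  intro φ dφ hφ hd
  simp_rw [mul_assoc]
  rw [integral_const_mul, integral_const_mul, hu φ dφ hφ hd]
  ring

lemma IsWeakDeriv.congr {u du v dv : Circ → ℝ} (hu : IsWeakDeriv u du) (h : u =ᵐ[sigma] v)
    (hd : du =ᵐ[sigma] dv) : IsWeakDeriv v dv := by
  intro φ dφ hφ hdφ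
  have e1 : ∫ x, u x * dφ x ∂sigma = ∫ x, v x * dφ x ∂sigma :=
    integral_congr_ae (by filter_upwards [h] with x hx; rw [hx])
  have e2 : ∫ x, du x * φ x ∂sigma = ∫ x, dv x * φ x ∂sigma :=
    integral_congr_ae (by filter_upwards [hd] with x hx; rw [hx])
  rw [← e1, ← e2, hu φ dφ hφ hdφ]

/-- The derivative is tested against the constant function `1`. -/
lemma IsWeakDeriv.integral_eq_zero {u du : Circ → ℝ} (hu : IsWeakDeriv u du) :
    ∫ x, du x ∂sigma = 0 := by
  have := hu (fun _ => 1) (fun _ => 0) contDiff_const (fun x => hasDerivAt_const _ _)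
  simpa using this.symm

/-- A function with weak derivative zero is constant: its Fourier coefficients of nonzero order
vanish. -/
lemma ae_const_of_isWeakDeriv_zero {u : Circ → ℝ} (hu : MemLp u 2 sigma)
    (h : IsWeakDeriv u fun _ => 0) : ∃ c : ℝ, u =ᵐ[sigma] fun _ => c := by
  have iu : Integrable u sigma := hu.integrable (by norm_num)
  have hf : MemLp (fun x => (u x : ℂ)) 2 sigma := hu.ofReal
  have hcoef : ∀ n : ℤ, n ≠ 0 → fourierCoeff (fun x => (u x : ℂ)) n = 0 := by
    intro n hn
    set k : ℂ := ((2 * Real.pi : ℝ) : ℂ) / (-2 * Real.pi * Complex.I * n)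
    have hd := has_antideriv_at_fourier_neg (T := 2 * Real.pi) inferInstance hn
    have hF : ContDiff ℝ ∞ (fun x : ℝ => k * (fourier (-n) (x : Circ) : ℂ)) := by
      apply contDiff_const.mul
      simp_rw [fourier_coe_apply]
      have : ContDiff ℝ ∞ fun x : ℝ => (x : ℂ) := Complex.ofRealCLM.contDiff
      fun_prop
    have hre := h (fun x => (k * fourier (-n) x).re) (fun x => (fourier (-n) x : ℂ).re)
      (Complex.reCLM.contDiff.comp hF) (fun x =>
        Complex.reCLM.hasFDerivAt.comp_hasDerivAt x (hd x))
    have him := h (fun x => (k * fourier (-n) x).im) (fun x => (fourier (-n) x : ℂ).im)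
      (Complex.imCLM.contDiff.comp hF) (fun x =>
        Complex.imCLM.hasFDerivAt.comp_hasDerivAt x (hd x))
    have hint : Integrable (fun x => fourier (-n) x • (u x : ℂ)) sigma :=
      (hf.integrable (by norm_num)).fourier_smul (-n)
    simp only [zero_mul, integral_zero, neg_zero] at hre him
    rw [fourierCoeff]
    apply Complex.ext
    · rw [← RCLike.re_eq_complex_re, ← integral_re hint]
      simpa [mul_comm] using hre
    · rw [← RCLike.im_eq_complex_im, ← integral_im hint]
      simpa [mul_comm] using him
  have hs := hasSum_fourier_series_L2 (hf.toLp _)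
  have hs2 := hasSum_single (f := fun i : ℤ => fourierCoeff (hf.toLp _) i •
    fourierLp (T := 2 * Real.pi) 2 i) 0
    (fun n hn => by
      rw [fourierCoeff_congr_ae hf.coeFn_toLp, hcoef n hn, zero_smul])
  have he := hs.unique hs2
  refine ⟨(fourierCoeff (hf.toLp _) 0).re, ?_⟩
  have h1 := hf.coeFn_toLp
  have h2 := Lp.coeFn_smul (fourierCoeff (hf.toLp _) 0) (fourierLp (T := 2 * Real.pi) 2 0)
  rw [← he] at h2
  filter_upwards [h1, h2, coeFn_fourierLp (T := 2 * Real.pi) 2 0] with x hx1 hx2 hx3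
  rw [hx1, Pi.smul_apply, hx3, fourier_zero, smul_eq_mul, mul_one] at hx2
  rw [← hx2, Complex.ofReal_re]

/-- Functions of `W^{1,p}` with `p ≥ 2` are, up to null sets, primitives of their weak
derivative. -/
lemma IsW1p.exists_isPrimitive {p : ℝ} (hp : 2 ≤ p) {u du : Circ → ℝ} (h : IsW1p p u du) :
    ∃ U : Circ → ℝ, IsPrimitive U du ∧ u =ᵐ[sigma] U := by
  have h2 : (2 : ENNReal) ≤ ENNReal.ofReal p := by
    rw [← ENNReal.ofReal_ofNat]; exact ENNReal.ofReal_le_ofReal hp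
  have hu2 : MemLp u 2 sigma := h.memLp.mono_exponent h2
  have hdu2 : MemLp du 2 sigma := h.memLp_deriv.mono_exponent h2
  have iu : Integrable u sigma := hu2.integrable (by norm_num)
  have idu : Integrable du sigma := hdu2.integrable (by norm_num)
  obtain ⟨W, hW, -⟩ := KLT.exists_isPrimitive idu h.weakDeriv.integral_eq_zero 0
  have hWc := hW.continuous
  have hW2 : MemLp W 2 sigma := by
    obtain ⟨C, hC⟩ := isCompact_univ.exists_bound_of_continuousOn hWc.continuousOn
    exact MemLp.of_bound hWc.aestronglyMeasurable C (.of_forall fun x => hC x trivial)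
  have iW : Integrable W sigma := hW2.integrable (by norm_num)
  have hz := h.weakDeriv.add (hW.isWeakDeriv.const_mul (-1)) iu idu (iW.const_mul _)
    (idu.const_mul _)
  have hz' : IsWeakDeriv (fun x => u x + -1 * W x) fun _ => 0 :=
    hz.congr (.refl _ _) (.of_forall fun x => by ring)
  obtain ⟨c, hc⟩ := ae_const_of_isWeakDeriv_zero (hu2.add (hW2.const_mul (-1))) hz'
  refine ⟨fun x => W x + c, ⟨idu, fun x y => ?_⟩, ?_⟩
  · rw [← hW.sub_eq]; ring
  · filter_upwards [hc] with x hx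
    simp only [Pi.add_apply] at hx
    linarith

/-! ### Sobolev functions on the circle -/

lemma memLp_of_continuous {f : Circ → ℝ} (hf : Continuous f) (r : ENNReal) : MemLp f r sigma := by
  obtain ⟨C, hC⟩ := isCompact_univ.exists_bound_of_continuousOn hf.continuousOn
  exact MemLp.of_bound hf.aestronglyMeasurable C (.of_forall fun x => hC x trivial)

lemma integrable_of_continuous {f : Circ → ℝ} (hf : Continuous f) : Integrable f sigma :=
  (memLp_of_continuous hf 1).integrable le_rfl

lemma integral_abs_le_nrm {r : ℝ} (hr : 1 ≤ r) {f : Circ → ℝ}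
    (hf : MemLp f (ENNReal.ofReal r) sigma) : ∫ x, |f x| ∂sigma ≤ nrm r f := by
  have := nrm_mono_exponent one_pos hr hf
  simpa [nrm] using this

lemma IsPrimitive.isW1p {p : ℝ} {U g : Circ → ℝ} (h : IsPrimitive U g)
    (hg : MemLp g (ENNReal.ofReal p) sigma) : IsW1p p U g :=
  ⟨memLp_of_continuous h.continuous _, hg, h.isWeakDeriv⟩

lemma isPrimitive_const (c : ℝ) : IsPrimitive (fun _ => c) (fun _ => 0) :=
  ⟨integrable_zero _ _ _, fun x y => by simp⟩

lemma isW1p_const (p c : ℝ) : IsW1p p (fun _ => c) (fun _ => 0) :=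
  (isPrimitive_const c).isW1p MemLp.zero'

lemma IsPrimitive.add {U g W h : Circ → ℝ} (hU : IsPrimitive U g) (hW : IsPrimitive W h) :
    IsPrimitive (fun x => U x + W x) (fun x => g x + h x) :=
  ⟨hU.integrable.add hW.integrable, fun x y => by
    rw [intervalIntegral.integral_add (intervalIntegrable_lift hU.integrable x y)
      (intervalIntegrable_lift hW.integrable x y), ← hU.sub_eq, ← hW.sub_eq]
    ring⟩

lemma IsPrimitive.const_mul {U g : Circ → ℝ} (hU : IsPrimitive U g) (c : ℝ) :
    IsPrimitive (fun x => c * U x) (fun x => c * g x) :=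
  ⟨hU.integrable.const_mul c, fun x y => by
    rw [intervalIntegral.integral_const_mul, ← hU.sub_eq]
    ring⟩

lemma IsPrimitive.dist_le {U g : Circ → ℝ} (h : IsPrimitive U g) (x y : Circ) :
    |U x - U y| ≤ 2 * Real.pi * ∫ z, |g z| ∂sigma := by
  obtain ⟨a, rfl⟩ := QuotientAddGroup.mk_surjective y
  set b : ℝ := (AddCircle.equivIoc (2 * Real.pi) a x : ℝ)
  have hb : b ∈ Set.Ioc a (a + 2 * Real.pi) := (AddCircle.equivIoc (2 * Real.pi) a x).2
  have hx : (b : Circ) = x := (AddCircle.equivIoc (2 * Real.pi) a).symm_apply_apply x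
  have hi := fun s t => (intervalIntegrable_lift h.integrable.abs s t)
  have e : U x - U (a : Circ) = ∫ t in a..b, g t := by rw [← h.sub_eq, hx]
  have h1 : |∫ t in a..b, g t| ≤ ∫ t in a..b, |g t| :=
    intervalIntegral.abs_integral_le_integral_abs hb.1.le
  have h2 : ∫ t in a..b, |g t| ≤ ∫ t in a..a + 2 * Real.pi, |g t| := by
    rw [← intervalIntegral.integral_add_adjacent_intervals (hi a b) (hi b
      (a + 2 * Real.pi))]
    have : 0 ≤ ∫ t in b..a + 2 * Real.pi, |g t| :=
      intervalIntegral.integral_nonneg hb.2 fun t _ => abs_nonneg _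
    linarith
  have h3 : 2 * Real.pi * ∫ z, |g z| ∂sigma = ∫ t in a..a + 2 * Real.pi, |g t| := by
    rw [integral_sigma _ a, ← mul_assoc, mul_inv_cancel₀ Real.two_pi_pos.ne', one_mul]
  rw [h3]
  change |U x - U (a : Circ)| ≤ _
  rw [e]
  exact h1.trans h2

lemma IsPrimitive.abs_le {U g : Circ → ℝ} (h : IsPrimitive U g) (x : Circ) :
    |U x| ≤ 2 * Real.pi * (∫ z, |g z| ∂sigma) + ∫ z, |U z| ∂sigma := by
  have hi := integrable_of_continuous h.continuous.abs
  have h1 : ∫ y, |U x| ∂sigma ≤ ∫ y, (2 * Real.pi * (∫ z, |g z| ∂sigma) + |U y|) ∂sigma := by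
    apply integral_mono (integrable_const _) ((integrable_const _).add hi)
    intro y
    have := abs_sub_abs_le_abs_sub (U x) (U y)
    have := h.dist_le x y
    simp only [Pi.add_apply]
    linarith
  rw [integral_add (integrable_const _) hi] at h1
  simpa using h1

lemma IsPrimitive.abs_le_nrm {p : ℝ} (hp : 1 ≤ p) {U g : Circ → ℝ} (h : IsPrimitive U g)
    (hg : MemLp g (ENNReal.ofReal p) sigma) (x : Circ) :
    |U x| ≤ 2 * Real.pi * nrm p g + nrm p U := by
  have h1 := h.abs_le x
  have h2 := integral_abs_le_nrm hp hg
  have h3 := integral_abs_le_nrm hp (memLp_of_continuous h.continuous (ENNReal.ofReal p))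
  have h4 := mul_le_mul_of_nonneg_left h2 Real.two_pi_pos.le
  linarith

lemma IsW1p.memLp_of_two_le {p : ℝ} (hp : 2 ≤ p) {u du : Circ → ℝ} (h : IsW1p p u du)
    (r : ENNReal) : MemLp u r sigma := by
  obtain ⟨U, hU, he⟩ := h.exists_isPrimitive hp
  exact (memLp_congr_ae he).2 (memLp_of_continuous hU.continuous r)

/-- Interpolation of the `L^q` norm between the `L^p` norm and the sup norm, the latter being
controlled by the `W^{1,p}` norm. -/
lemma IsW1p.nrm_interpolation {p q : ℝ} (hp : 2 ≤ p) (hpq : p < q) {u du : Circ → ℝ}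
    (h : IsW1p p u du) :
    nrm q u ≤ (2 * Real.pi * nrm p du + nrm p u) ^ (1 - p / q) * nrm p u ^ (p / q) := by
  obtain ⟨U, hU, he⟩ := h.exists_isPrimitive hp
  have hq : 0 < q := by linarith
  rw [nrm_congr he, nrm_congr he (r := p)]
  set M := 2 * Real.pi * nrm p du + nrm p U
  have hM : 0 ≤ M := by
    have := nrm_nonneg p du
    have := nrm_nonneg p U
    have := Real.pi_pos
    positivity
  have hb : ∀ x, |U x| ≤ M := hU.abs_le_nrm (by linarith) h.memLp_deriv
  have h1 : nrm q U ^ q ≤ M ^ (q - p) * nrm p U ^ p := by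
    rw [nrm_rpow hq, nrm_rpow (by linarith), ← integral_const_mul]
    apply integral_mono
      (integrable_rpow_abs hq (memLp_of_continuous hU.continuous _))
      ((integrable_rpow_abs (by linarith) (memLp_of_continuous hU.continuous _)).const_mul _)
    intro x
    simp only
    calc |U x| ^ q = |U x| ^ (q - p) * |U x| ^ p := by
          rw [← Real.rpow_add' (abs_nonneg _) (by linarith)]; simp
      _ ≤ M ^ (q - p) * |U x| ^ p := by
          apply mul_le_mul_of_nonneg_right _ (Real.rpow_nonneg (abs_nonneg _) _)
          exact Real.rpow_le_rpow (abs_nonneg _) (hb x) (by linarith)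
  have h2 := Real.rpow_le_rpow (Real.rpow_nonneg (nrm_nonneg q U) _) h1 (inv_nonneg.2 hq.le)
  rw [← Real.rpow_mul (nrm_nonneg q U), mul_inv_cancel₀ hq.ne', Real.rpow_one,
    Real.mul_rpow (Real.rpow_nonneg hM _) (Real.rpow_nonneg (nrm_nonneg p U) _),
    ← Real.rpow_mul hM, ← Real.rpow_mul (nrm_nonneg p U)] at h2
  rwa [show (q - p) * q⁻¹ = 1 - p / q by field_simp, ← div_eq_mul_inv] at h2

/-- The modulus of continuity of a primitive of a function in `L²`, from
`|g| ≤ K + g² / K` for every `K > 0`. -/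
lemma IsPrimitive.abs_sub_le {U g : Circ → ℝ} (h : IsPrimitive U g) (h2 : MemLp g 2 sigma)
    {K : ℝ} (hK : 0 < K) {s t : ℝ} (hst : s ≤ t) (hts : t ≤ s + 2 * Real.pi) :
    |U (t : Circ) - U (s : Circ)| ≤ K * (t - s) + 2 * Real.pi * (∫ x, g x ^ 2 ∂sigma) / K := by
  have hi := intervalIntegrable_lift h2.integrable_sq
  have hg := intervalIntegrable_lift h.integrable.abs
  have h3 : 2 * Real.pi * ∫ z, g z ^ 2 ∂sigma = ∫ t in s..s + 2 * Real.pi, g t ^ 2 := by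
    rw [integral_sigma _ s, ← mul_assoc, mul_inv_cancel₀ Real.two_pi_pos.ne', one_mul]
  rw [h.sub_eq, h3]
  calc |∫ r in s..t, g r| ≤ ∫ r in s..t, |g r| :=
        intervalIntegral.abs_integral_le_integral_abs hst
    _ ≤ ∫ r in s..t, (K + g r ^ 2 / K) := by
        apply intervalIntegral.integral_mono_on hst (hg s t)
          (intervalIntegrable_const.add ((hi s t).div_const K))
        intro r _
        have h4 : K * |g r| ≤ K * K + |g r| ^ 2 := by
          nlinarith [sq_nonneg (|g r| - K), sq_nonneg (|g r|)]
        rw [sq_abs] at h4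
        have h5 : K + g r ^ 2 / K = (K * K + g r ^ 2) / K := by field_simp
        rw [h5, le_div_iff₀ hK]
        linarith
    _ = K * (t - s) + (∫ r in s..t, g r ^ 2) / K := by
        rw [intervalIntegral.integral_add intervalIntegrable_const ((hi s t).div_const K),
          intervalIntegral.integral_const, intervalIntegral.integral_div, smul_eq_mul]
        ring
    _ ≤ _ := by
        rw [← intervalIntegral.integral_add_adjacent_intervals (hi s t)
          (hi t (s + 2 * Real.pi))]
        have : 0 ≤ ∫ r in t..s + 2 * Real.pi, g r ^ 2 :=
          intervalIntegral.integral_nonneg hts fun t _ => sq_nonneg _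
        gcongr
        linarith

/-- A family of primitives of functions bounded in `L²` is equicontinuous. -/
lemma equicontinuous_of_isPrimitive {ι : Type*} {U g : ι → Circ → ℝ} {A : ℝ}
    (h : ∀ i, IsPrimitive (U i) (g i)) (h2 : ∀ i, MemLp (g i) 2 sigma)
    (hA : ∀ i, ∫ x, g i x ^ 2 ∂sigma ≤ A) : Equicontinuous U := by
  intro x
  obtain ⟨a, rfl⟩ := QuotientAddGroup.mk_surjective x
  rw [Metric.equicontinuousAt_iff_right]
  intro ε hε
  rw [QuotientAddGroup.nhds_eq, Filter.eventually_map]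
  set K : ℝ := 4 * Real.pi * |A| / ε + 1
  have hK : 0 < K := by have := Real.pi_pos; positivity
  have hK2 : 2 * Real.pi * |A| / K < ε / 2 := by
    rw [div_lt_iff₀ hK]
    have : ε / 2 * K = 2 * Real.pi * |A| + ε / 2 := by simp only [K]; field_simp; ring
    linarith
  have hd : 0 < min (2 * Real.pi) (ε / (2 * K)) := lt_min Real.two_pi_pos (by positivity)
  filter_upwards [Metric.ball_mem_nhds a hd] with b hb i
  rw [Metric.mem_ball, Real.dist_eq, lt_min_iff, lt_div_iff₀ (by positivity)] at hb
  have hAi : 2 * Real.pi * (∫ x, g i x ^ 2 ∂sigma) / K ≤ 2 * Real.pi * |A| / K := by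
    have := (hA i).trans (le_abs_self A)
    have := Real.pi_pos
    gcongr
  rw [Real.dist_eq]
  rcases le_total a b with hab | hab
  · rw [abs_of_nonneg (sub_nonneg.2 hab)] at hb
    have := (h i).abs_sub_le (h2 i) hK hab (by linarith)
    rw [abs_sub_comm]
    exact this.trans_lt (by linarith)
  · rw [abs_of_nonpos (sub_nonpos.2 hab)] at hb
    have := (h i).abs_sub_le (h2 i) hK hab (by linarith)
    exact this.trans_lt (by linarith)

/-- The absolute value of a primitive is a primitive, of a function which is no larger. -/
lemma IsPrimitive.exists_abs {U g : Circ → ℝ} (h : IsPrimitive U g) :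
    ∃ g' : Circ → ℝ, IsPrimitive (fun x => |U x|) g' ∧ ∀ᵐ x ∂sigma, |g' x| ≤ |g x| := by
  set F : ℝ → ℝ := fun t => |U t|
  have hper : Function.Periodic F (2 * Real.pi) := fun t => by
    simp [F]
  have hdper : Function.Periodic (deriv F) (2 * Real.pi) := fun t => by
    have : (fun s => F (s + 2 * Real.pi)) = F := funext hper
    rw [← deriv_comp_add_const, this]
  have hac : ∀ a b, AbsolutelyContinuousOnInterval F a b := by
    intro a b
    have := h.absolutelyContinuous a b
    rw [absolutelyContinuousOnInterval_iff] at this ⊢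
    intro ε hε
    obtain ⟨δ, hδ, H⟩ := this ε hε
    refine ⟨δ, hδ, fun E hE hl => (Finset.sum_le_sum fun i _ => ?_).trans_lt (H E hE hl)⟩
    exact abs_abs_sub_abs_le _ _
  set g' : Circ → ℝ := fun x => deriv F (AddCircle.measurableEquivIoc (2 * Real.pi) 0 x : ℝ)
  have hg' : ∀ t : ℝ, g' t = deriv F t := by
    intro t
    have hx : (((AddCircle.equivIoc (2 * Real.pi) 0 (t : Circ) : ℝ)) : Circ) = t :=
      (AddCircle.equivIoc (2 * Real.pi) 0).symm_apply_apply (t : Circ)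
    have := hdper.lift_coe t
    rw [← hx, hdper.lift_coe] at this
    exact this
  have hm : Measurable g' :=
    (measurable_deriv F).comp
      (measurable_subtype_coe.comp (AddCircle.measurableEquivIoc (2 * Real.pi) 0).measurable)
  have hle : ∀ᵐ x ∂sigma, |g' x| ≤ |g x| := by
    apply ae_descend
    filter_upwards [h.ae_hasDerivAt] with t ht
    rw [hg']
    by_cases hd : DifferentiableAt ℝ F t
    · have h1 := (hasDerivAt_iff_tendsto_slope.1 hd.hasDerivAt).abs
      have h2 := (hasDerivAt_iff_tendsto_slope.1 ht).abs
      refine le_of_tendsto_of_tendsto h1 h2 (.of_forall fun s => ?_)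
      simp only [slope_def_field, abs_div]
      exact div_le_div_of_nonneg_right (abs_abs_sub_abs_le _ _) (abs_nonneg _)
    · rw [deriv_zero_of_not_differentiableAt hd]
      simp
  refine ⟨g', ⟨?_, fun x y => ?_⟩, hle⟩
  · exact h.integrable.mono hm.aestronglyMeasurable hle
  · simp_rw [hg']
    rw [(hac x y).integral_deriv_eq_sub]

open Filter Topology

/-! ### The optimal constant -/

lemma energy_nonneg (p l : ℝ) (hl : 0 ≤ l) (u du : Circ → ℝ) :
    0 ≤ nrm p du ^ 2 + l * nrm p u ^ 2 := by
  positivity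

lemma mu_bddBelow (p q : ℝ) {l : ℝ} (hl : 0 ≤ l) :
    BddBelow {t : ℝ | ∃ u du : Circ → ℝ, IsW1p p u du ∧ NonZero u ∧
      t = (nrm p du ^ 2 + l * nrm p u ^ 2) / nrm q u ^ 2} := by
  refine ⟨0, ?_⟩
  rintro t ⟨u, du, -, -, rfl⟩
  exact div_nonneg (energy_nonneg p l hl u du) (sq_nonneg _)

lemma nonZero_const {c : ℝ} (hc : c ≠ 0) : NonZero fun _ => c := fun h => by
  obtain ⟨x, hx⟩ := h.exists
  exact hc hx

lemma mu_nonempty (p q l : ℝ) :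
    {t : ℝ | ∃ u du : Circ → ℝ, IsW1p p u du ∧ NonZero u ∧
      t = (nrm p du ^ 2 + l * nrm p u ^ 2) / nrm q u ^ 2}.Nonempty :=
  ⟨_, fun _ => 1, fun _ => 0, isW1p_const p 1, nonZero_const one_ne_zero, rfl⟩

lemma nrm_eq_zero_of_not_nonZero {r : ℝ} (hr : 0 < r) {u : Circ → ℝ} (h : ¬ NonZero u) :
    nrm r u = 0 := by
  rw [nrm_congr (not_not.1 h), nrm_const hr, abs_zero]

/-- The interpolation inequality with optimal constant. -/
lemma mu_mul_le {p q l : ℝ} (hp : 2 < p) (hpq : p < q) (hl : 0 ≤ l) {u du : Circ → ℝ}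
    (h : IsW1p p u du) : mu p q l * nrm q u ^ 2 ≤ nrm p du ^ 2 + l * nrm p u ^ 2 := by
  by_cases hu : NonZero u
  · have hpos : 0 < nrm q u := nrm_pos (by linarith) (h.memLp_of_two_le hp.le _) hu
    rw [← le_div_iff₀ (by positivity)]
    exact csInf_le (mu_bddBelow p q hl) ⟨u, du, h, hu, rfl⟩
  · rw [nrm_eq_zero_of_not_nonZero (by linarith) hu]
    simpa using energy_nonneg p l hl u du

lemma le_mu {p q l m : ℝ} (hp : 2 < p) (hpq : p < q)
    (H : ∀ u du : Circ → ℝ, IsW1p p u du → NonZero u →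
      m * nrm q u ^ 2 ≤ nrm p du ^ 2 + l * nrm p u ^ 2) : m ≤ mu p q l := by
  apply le_csInf (mu_nonempty p q l)
  rintro t ⟨u, du, h, hu, rfl⟩
  have hpos : 0 < nrm q u := nrm_pos (by linarith) (h.memLp_of_two_le hp.le _) hu
  rw [le_div_iff₀ (by positivity)]
  exact H u du h hu

lemma mu_nonneg {p q l : ℝ} (hp : 2 < p) (hpq : p < q) (hl : 0 ≤ l) : 0 ≤ mu p q l :=
  le_mu hp hpq fun u du _ _ => by simpa using energy_nonneg p l hl u du

lemma mu_le_self {p q l : ℝ} (hp : 2 < p) (hpq : p < q) (hl : 0 ≤ l) : mu p q l ≤ l := by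
  have := mu_mul_le hp hpq hl (isW1p_const p 1)
  rw [nrm_const (by linarith), nrm_const (by linarith), nrm_const (by linarith)] at this
  simpa using this

/-! ### Existence of a minimizer -/

/-- Clarkson's inequality for exponents at least `2`, for real numbers. -/
lemma clarkson_real {p : ℝ} (hp : 2 ≤ p) (a b : ℝ) :
    |1 / 2 * (a + b)| ^ p + |1 / 2 * (a + -1 * b)| ^ p ≤ (|a| ^ p + |b| ^ p) / 2 := by
  have hr : 1 ≤ p / 2 := by linarith
  have e : ∀ x : ℝ, |x| ^ p = (x ^ 2) ^ (p / 2) := fun x => by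
    rw [← sq_abs, ← Real.rpow_natCast, ← Real.rpow_mul (abs_nonneg x)]
    congr 1; push_cast; ring
  rw [e, e, e, e]
  have h1 := Real.add_rpow_le_rpow_add (sq_nonneg (1 / 2 * (a + b)))
    (sq_nonneg (1 / 2 * (a + -1 * b))) hr
  have h2 := (convexOn_rpow hr).2 (Set.mem_Ici.2 (sq_nonneg a)) (Set.mem_Ici.2 (sq_nonneg b))
    (by norm_num : (0 : ℝ) ≤ 1 / 2) (by norm_num : (0 : ℝ) ≤ 1 / 2) (by norm_num)
  simp only [smul_eq_mul] at h2
  have e2 : (1 / 2 * (a + b)) ^ 2 + (1 / 2 * (a + -1 * b)) ^ 2 = 1 / 2 * a ^ 2 + 1 / 2 * b ^ 2 := by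
    ring
  rw [e2] at h1
  linarith

lemma clarkson {p : ℝ} (hp : 2 ≤ p) {f g : Circ → ℝ} (hf : MemLp f (ENNReal.ofReal p) sigma)
    (hg : MemLp g (ENNReal.ofReal p) sigma) :
    nrm p (fun x => 1 / 2 * (f x + g x)) ^ p + nrm p (fun x => 1 / 2 * (f x + -1 * g x)) ^ p ≤
      (nrm p f ^ p + nrm p g ^ p) / 2 := by
  have h0 : 0 < p := by linarith
  have i1 : Integrable (fun x => |1 / 2 * (f x + g x)| ^ p) sigma :=
    integrable_rpow_abs h0 ((hf.add hg).const_mul (1 / 2))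
  have i2 : Integrable (fun x => |1 / 2 * (f x + -1 * g x)| ^ p) sigma :=
    integrable_rpow_abs h0 ((hf.add (hg.const_mul (-1))).const_mul (1 / 2))
  have i3 := integrable_rpow_abs h0 hf
  have i4 := integrable_rpow_abs h0 hg
  rw [nrm_rpow h0, nrm_rpow h0, nrm_rpow h0, nrm_rpow h0, ← integral_add i1 i2,
    ← integral_add i3 i4, ← integral_div]
  exact integral_mono (i1.add i2) ((i3.add i4).div_const 2) fun x => clarkson_real hp (f x) (g x)

lemma abs_nrm_sub_le {r : ℝ} (hr : 1 ≤ r) {f g : Circ → ℝ}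
    (hf : MemLp f (ENNReal.ofReal r) sigma) (hg : MemLp g (ENNReal.ofReal r) sigma) :
    |nrm r f - nrm r g| ≤ nrm r (fun x => f x + -1 * g x) := by
  have h0 : 0 < r := by linarith
  have key : ∀ {a b : Circ → ℝ}, MemLp a (ENNReal.ofReal r) sigma →
      MemLp b (ENNReal.ofReal r) sigma → nrm r a ≤ nrm r (fun x => a x + -1 * b x) + nrm r b := by
    intro a b ha hb
    have := nrm_add_le hr (ha.add (hb.const_mul (-1))) hb
    have e : (fun x => (a + fun x => -1 * b x) x + b x) = a := by
      ext x; simp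
    rw [e] at this
    exact this
  have e : nrm r (fun x => g x + -1 * f x) = nrm r (fun x => f x + -1 * g x) :=
    nrm_congr_abs (.of_forall fun x => by rw [← abs_neg]; congr 1; ring)
  have h1 := key hf hg
  have h2 := key hg hf
  rw [e] at h2
  rw [abs_le]
  constructor <;> linarith

lemma abs_nrm_sub_le_of_bound {r : ℝ} (hr : 1 ≤ r) {f g : Circ → ℝ} (hf : Continuous f)
    (hg : Continuous g) {C : ℝ} (hC : 0 ≤ C) (h : ∀ x, |f x - g x| ≤ C) :
    |nrm r f - nrm r g| ≤ C :=
  (abs_nrm_sub_le hr (memLp_of_continuous hf _) (memLp_of_continuous hg _)).trans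
    (nrm_le_of_bound (by linarith) hC (.of_forall fun x => by
      rw [neg_one_mul, ← sub_eq_add_neg]; exact h x))

/-- A sequence which is Cauchy for the norm converges. -/
lemma exists_tendsto_of_cauchy {p : ℝ} (hp : 1 ≤ p) {g : ℕ → Circ → ℝ}
    (hg : ∀ n, MemLp (g n) (ENNReal.ofReal p) sigma)
    (hc : Tendsto (fun i : ℕ × ℕ => nrm p (fun x => g i.1 x + -1 * g i.2 x))
      (atTop ×ˢ atTop) (𝓝 0)) :
    ∃ G : Circ → ℝ, MemLp G (ENNReal.ofReal p) sigma ∧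
      Tendsto (fun n => nrm p (fun x => g n x + -1 * G x)) atTop (𝓝 0) := by
  have : Fact (1 ≤ ENNReal.ofReal p) := ⟨by simpa using hp⟩
  have hp0 : 0 < p := by linarith
  have hd : ∀ {a b : Circ → ℝ} (ha : MemLp a (ENNReal.ofReal p) sigma)
      (hb : MemLp b (ENNReal.ofReal p) sigma),
      dist (ha.toLp a) (hb.toLp b) = nrm p (fun x => a x + -1 * b x) := by
    intro a b ha hb
    rw [dist_eq_norm, ← MemLp.toLp_sub, Lp.norm_toLp, ← nrm_eq_toReal hp0 (ha.sub hb)]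
    congr 1
    ext x
    simp only [Pi.sub_apply]
    ring
  have hcs : CauchySeq fun n => (hg n).toLp (g n) := by
    rw [cauchySeq_iff_tendsto_dist_atTop_0, ← prod_atTop_atTop_eq]
    refine hc.congr fun i => (hd _ _).symm
  obtain ⟨G, hG⟩ := cauchySeq_tendsto_of_complete hcs
  refine ⟨G, Lp.memLp G, ?_⟩
  rw [tendsto_iff_dist_tendsto_zero] at hG
  refine hG.congr fun n => ?_
  rw [← hd (hg n) (Lp.memLp G), Lp.toLp_coeFn]

lemma isWeakDeriv_of_tendsto {p : ℝ} (hp : 1 ≤ p) {U g : ℕ → Circ → ℝ} {F G : Circ → ℝ}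
    (h : ∀ n, IsW1p p (U n) (g n)) (hF : MemLp F (ENNReal.ofReal p) sigma)
    (hG : MemLp G (ENNReal.ofReal p) sigma)
    (hU : Tendsto (fun n => nrm p (fun x => U n x + -1 * F x)) atTop (𝓝 0))
    (hg : Tendsto (fun n => nrm p (fun x => g n x + -1 * G x)) atTop (𝓝 0)) :
    IsWeakDeriv F G := by
  have key : ∀ {a : ℕ → Circ → ℝ} {A ψ : Circ → ℝ}, (∀ n, MemLp (a n) (ENNReal.ofReal p) sigma) →
      MemLp A (ENNReal.ofReal p) sigma → Continuous ψ →
      Tendsto (fun n => nrm p (fun x => a n x + -1 * A x)) atTop (𝓝 0) →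
      Tendsto (fun n => ∫ x, a n x * ψ x ∂sigma) atTop (𝓝 (∫ x, A x * ψ x ∂sigma)) := by
    intro a A ψ ha hA hψ ht
    obtain ⟨C, hC⟩ := isCompact_univ.exists_bound_of_continuousOn hψ.continuousOn
    have hone : (1 : ENNReal) ≤ ENNReal.ofReal p := by simpa using hp
    have hi : ∀ {f : Circ → ℝ}, MemLp f (ENNReal.ofReal p) sigma →
        Integrable (fun x => f x * ψ x) sigma := fun hf =>
      (hf.integrable hone).mul_bdd hψ.aestronglyMeasurable (.of_forall fun x => hC x trivial)
    rw [tendsto_iff_dist_tendsto_zero]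
    refine squeeze_zero (fun _ => dist_nonneg) (fun n => ?_) (mul_zero C ▸ ht.const_mul C)
    have hd : MemLp (fun x => a n x + -1 * A x) (ENNReal.ofReal p) sigma :=
      (ha n).add (hA.const_mul (-1))
    rw [Real.dist_eq, ← integral_sub (hi (ha n)) (hi hA)]
    calc |∫ x, (a n x * ψ x - A x * ψ x) ∂sigma|
        ≤ ∫ x, |a n x * ψ x - A x * ψ x| ∂sigma := abs_integral_le_integral_abs
      _ ≤ ∫ x, C * |a n x + -1 * A x| ∂sigma := by
          apply integral_mono ((hi (ha n)).sub (hi hA)).abs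
            ((hd.integrable hone).abs.const_mul C)
          intro x
          simp only [Pi.sub_apply]
          rw [← sub_mul, abs_mul, mul_comm, neg_one_mul, ← sub_eq_add_neg]
          exact mul_le_mul_of_nonneg_right (hC x trivial) (abs_nonneg _)
      _ ≤ C * nrm p (fun x => a n x + -1 * A x) := by
          rw [integral_const_mul]
          exact mul_le_mul_of_nonneg_left (integral_abs_le_nrm hp hd)
            ((norm_nonneg _).trans (hC 0 trivial))
  intro φ dφ hφ hd
  have cφ : Continuous φ := continuous_of_lift hφ.continuous
  have cdφ := continuous_of_hasDerivAt_lift hφ hd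
  have h1 := key (fun n => (h n).memLp) hF cdφ hU
  have h2 := (key (fun n => (h n).memLp_deriv) hG cφ hg).neg
  exact tendsto_nhds_unique (h1.congr fun n => (h n).weakDeriv φ dφ hφ hd) h2

/-- Near-optimal functions may be taken continuous and normalized in `L^q`. -/
lemma exists_minimizing_seq {p q l : ℝ} (hp : 2 < p) (hpq : p < q) {ε : ℝ}
    (hε : 0 < ε) : ∃ U g : Circ → ℝ, IsPrimitive U g ∧ MemLp g (ENNReal.ofReal p) sigma ∧
      nrm q U = 1 ∧ nrm p g ^ 2 + l * nrm p U ^ 2 < mu p q l + ε := by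
  obtain ⟨t, ⟨u, du, h, hu, rfl⟩, ht⟩ := exists_lt_of_csInf_lt (mu_nonempty p q l)
    (show mu p q l < mu p q l + ε by linarith)
  have hpos : 0 < nrm q u := nrm_pos (by linarith) (h.memLp_of_two_le hp.le _) hu
  obtain ⟨U, hU, he⟩ := h.exists_isPrimitive hp.le
  refine ⟨_, _, hU.const_mul (nrm q u)⁻¹, h.memLp_deriv.const_mul _, ?_, ?_⟩
  · rw [nrm_smul (by linarith), ← nrm_congr he, abs_of_pos (by positivity),
      inv_mul_cancel₀ hpos.ne']
  · rw [nrm_smul (by linarith), nrm_smul (by linarith), ← nrm_congr he (r := p),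
      abs_of_pos (by positivity)]
    calc _ = (nrm p du ^ 2 + l * nrm p u ^ 2) / nrm q u ^ 2 := by field_simp
      _ < _ := ht

lemma sq_rpow_half {x p : ℝ} (hx : 0 ≤ x) : (x ^ 2) ^ (p / 2) = x ^ p := by
  rw [← Real.rpow_natCast, ← Real.rpow_mul hx]
  congr 1; push_cast; ring

/-- The interpolation inequality has an optimal function. A minimizing sequence converges uniformly
along a subsequence, by Ascoli's theorem; then Clarkson's inequality shows that the derivatives
converge in `L^p`, because the midpoint of two almost minimizers is almost minimizing. -/
theorem exists_minimizer {p q l : ℝ} (hp : 2 < p) (hpq : p < q) (hl : 0 ≤ l) :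
    ∃ u du : Circ → ℝ, IsW1p p u du ∧ NonZero u ∧
      nrm p du ^ 2 + l * nrm p u ^ 2 = mu p q l * nrm q u ^ 2 := by
  have p0 : 0 < p := by linarith
  have p1 : 1 ≤ p := by linarith
  have q1 : 1 ≤ q := by linarith
  set m := mu p q l
  have hm : 0 ≤ m := mu_nonneg hp hpq hl
  choose U g hP hg hUq hJ using fun n : ℕ =>
    exists_minimizing_seq (l := l) hp hpq (Nat.one_div_pos_of_nat (α := ℝ) (n := n))
  have hW : ∀ n, IsW1p p (U n) (g n) := fun n => (hP n).isW1p (hg n)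
  have hJ1 : ∀ n, nrm p (g n) ^ 2 + l * nrm p (U n) ^ 2 ≤ m + 1 := fun n =>
    (hJ n).le.trans (by
      have : 1 / ((n : ℝ) + 1) ≤ 1 := by
        rw [div_le_one (by positivity)]; linarith [n.cast_nonneg (α := ℝ)]
      simp only [m]; linarith)
  have hgb : ∀ n, nrm p (g n) ^ 2 ≤ m + 1 := fun n => by
    have := hJ1 n
    have : 0 ≤ l * nrm p (U n) ^ 2 := by positivity
    linarith
  have hgb1 : ∀ n, nrm p (g n) ≤ m + 1 := fun n => by
    nlinarith [hgb n, nrm_nonneg p (g n)]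
  have hUp : ∀ n, nrm p (U n) ≤ 1 := fun n => by
    rw [← hUq n]
    exact nrm_mono_exponent p0 hpq.le (memLp_of_continuous (hP n).continuous _)
  have hUb : ∀ n x, |U n x| ≤ 2 * Real.pi * (m + 1) + 1 := fun n x => by
    have h1 := (hP n).abs_le_nrm p1 (hg n) x
    have h2 := mul_le_mul_of_nonneg_left (hgb1 n) Real.two_pi_pos.le
    linarith [hUp n]
  have h2p : (2 : ENNReal) ≤ ENNReal.ofReal p := by
    rw [← ENNReal.ofReal_ofNat]; exact ENNReal.ofReal_le_ofReal hp.le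
  have hg2 : ∀ n, MemLp (g n) 2 sigma := fun n => (hg n).mono_exponent h2p
  have heq : Equicontinuous U := by
    refine equicontinuous_of_isPrimitive (A := m + 1) hP hg2 fun n => ?_
    have h1 := nrm_mono_exponent two_pos hp.le (hg n)
    have h2 := nrm_rpow two_pos (g n)
    have h3 : ∫ x, |g n x| ^ (2 : ℝ) ∂sigma = ∫ x, g n x ^ 2 ∂sigma := by
      simp_rw [Real.rpow_two, sq_abs]
    rw [← h3, ← h2, Real.rpow_two]
    exact (pow_le_pow_left₀ (nrm_nonneg _ _) h1 2).trans (hgb n)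
  -- a uniformly convergent subsequence
  obtain ⟨F, φ, hφ, hF⟩ : ∃ (F : BoundedContinuousFunction Circ ℝ) (φ : ℕ → ℕ), StrictMono φ ∧
      Tendsto (fun n => BoundedContinuousFunction.mkOfCompact
        ⟨U (φ n), (hP (φ n)).continuous⟩) atTop (𝓝 F) := by
    set B : ℕ → BoundedContinuousFunction Circ ℝ := fun n =>
      BoundedContinuousFunction.mkOfCompact ⟨U n, (hP n).continuous⟩
    have hcomp : IsCompact (closure (Set.range B)) := by
      refine BoundedContinuousFunction.arzela_ascoli _
        (isCompact_Icc (a := -(2 * Real.pi * (m + 1) + 1)) (b := 2 * Real.pi * (m + 1) + 1))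
        _ ?_ ?_
      · rintro _ x ⟨n, rfl⟩
        exact abs_le.1 (hUb n x)
      · intro x V hV
        filter_upwards [heq x V hV] with y hy
        rintro ⟨_, n, rfl⟩
        exact hy n
    obtain ⟨F, -, φ, hφ, hF⟩ := hcomp.tendsto_subseq
      (fun n => subset_closure (Set.mem_range_self n) : ∀ n, B n ∈ closure (Set.range B))
    exact ⟨F, φ, hφ, hF⟩
  have hFc : Continuous F := F.continuous
  set e : ℕ → ℝ := fun n => dist (BoundedContinuousFunction.mkOfCompact
        ⟨U (φ n), (hP (φ n)).continuous⟩) F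
  have he : Tendsto e atTop (𝓝 0) := tendsto_iff_dist_tendsto_zero.1 hF
  have hUF : ∀ n x, |U (φ n) x - F x| ≤ e n := fun n x =>
    BoundedContinuousFunction.dist_coe_le_dist (f := BoundedContinuousFunction.mkOfCompact
        ⟨U (φ n), (hP (φ n)).continuous⟩) (g := F) x
  have hUn : ∀ r, 1 ≤ r → Tendsto (fun n => nrm r (U (φ n))) atTop (𝓝 (nrm r F)) := fun r hr => by
    rw [tendsto_iff_dist_tendsto_zero]
    exact squeeze_zero (fun _ => dist_nonneg) (fun n => abs_nrm_sub_le_of_bound hr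
      (hP (φ n)).continuous hFc dist_nonneg (hUF n)) he
  have hFq : nrm q F = 1 := by
    have := hUn q q1
    simp only [hUq] at this
    exact (tendsto_nhds_unique tendsto_const_nhds this).symm
  set D := m - l * nrm p F ^ 2
  have hgl : Tendsto (fun n => nrm p (g (φ n)) ^ 2) atTop (𝓝 D) := by
    have h1 : Tendsto (fun n => nrm p (g (φ n)) ^ 2 + l * nrm p (U (φ n)) ^ 2) atTop (𝓝 m) := by
      have h2 : Tendsto (fun n : ℕ => m + 1 / ((φ n : ℝ) + 1)) atTop (𝓝 m) := by
        have := (tendsto_one_div_add_atTop_nhds_zero_nat (𝕜 := ℝ)).comp hφ.tendsto_atTop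
        simpa using this.const_add m
      refine tendsto_of_tendsto_of_tendsto_of_le_of_le tendsto_const_nhds h2 (fun n => ?_)
        (fun n => (hJ (φ n)).le)
      have := mu_mul_le hp hpq hl (hW (φ n))
      rw [hUq, one_pow, mul_one] at this
      exact this
    have h3 := h1.sub (((hUn p p1).pow 2).const_mul l)
    refine h3.congr fun n => ?_
    ring
  have hD : 0 ≤ D := ge_of_tendsto' hgl fun n => sq_nonneg _
  have hgp : Tendsto (fun n => nrm p (g (φ n)) ^ p) atTop (𝓝 (D ^ (p / 2))) := by
    have := hgl.rpow_const (p := p / 2) (Or.inr (by positivity))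
    refine this.congr fun n => sq_rpow_half (nrm_nonneg _ _)
  -- midpoints
  have hmid : ∀ r, 1 ≤ r → Tendsto (fun i : ℕ × ℕ =>
      nrm r (fun x => 1 / 2 * (U (φ i.1) x + U (φ i.2) x))) (atTop ×ˢ atTop) (𝓝 (nrm r F)) := by
    intro r hr
    rw [tendsto_iff_dist_tendsto_zero]
    have h1 : Tendsto (fun i : ℕ × ℕ => 1 / 2 * (e i.1 + e i.2)) (atTop ×ˢ atTop) (𝓝 0) := by
      have := ((he.comp tendsto_fst).add
        (he.comp (tendsto_snd (f := (atTop : Filter ℕ))))).const_mul (1 / 2 : ℝ)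
      simpa using this
    refine squeeze_zero (fun _ => dist_nonneg) (fun i => ?_) h1
    have hc : Continuous fun x => 1 / 2 * (U (φ i.1) x + U (φ i.2) x) :=
      continuous_const.mul ((hP _).continuous.add (hP _).continuous)
    refine abs_nrm_sub_le_of_bound hr hc hFc (by positivity) fun x => ?_
    have h2 := abs_le.1 (hUF i.1 x)
    have h3 := abs_le.1 (hUF i.2 x)
    rw [abs_le]
    constructor <;> linarith
  have hcauchy : Tendsto (fun i : ℕ × ℕ => nrm p (fun x => g (φ i.1) x + -1 * g (φ i.2) x))
      (atTop ×ˢ atTop) (𝓝 0) := by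
    have hlow : Tendsto (fun i : ℕ × ℕ => (max 0
        (m * nrm q (fun x => 1 / 2 * (U (φ i.1) x + U (φ i.2) x)) ^ 2 -
          l * nrm p (fun x => 1 / 2 * (U (φ i.1) x + U (φ i.2) x)) ^ 2)) ^ (p / 2))
        (atTop ×ˢ atTop) (𝓝 (D ^ (p / 2))) := by
      have h1 := (((hmid q q1).pow 2).const_mul m).sub (((hmid p p1).pow 2).const_mul l)
      have h2 := (tendsto_const_nhds (x := (0 : ℝ))).max h1
      have h3 : max 0 (m * nrm q F ^ 2 - l * nrm p F ^ 2) = D := by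
        rw [hFq, one_pow, mul_one]; exact max_eq_right hD
      rw [h3] at h2
      exact h2.rpow_const (Or.inr (by positivity))
    have hup : Tendsto (fun i : ℕ × ℕ => (nrm p (g (φ i.1)) ^ p + nrm p (g (φ i.2)) ^ p) / 2)
        (atTop ×ˢ atTop) (𝓝 (D ^ (p / 2))) := by
      have := ((hgp.comp tendsto_fst).add
        (hgp.comp (tendsto_snd (f := (atTop : Filter ℕ))))).div_const (2 : ℝ)
      simpa using this
    have hdiff := hup.sub hlow
    rw [sub_self] at hdiff
    have h0 : Tendsto (fun i : ℕ × ℕ =>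
        nrm p (fun x => 1 / 2 * (g (φ i.1) x + -1 * g (φ i.2) x)) ^ p) (atTop ×ˢ atTop) (𝓝 0) := by
      refine squeeze_zero (fun i => Real.rpow_nonneg (nrm_nonneg _ _) _) (fun i => ?_) hdiff
      have h1 := clarkson hp.le (hg (φ i.1)) (hg (φ i.2))
      have h2 := mu_mul_le hp hpq hl
        ((((hP (φ i.1)).add (hP (φ i.2))).const_mul (1 / 2)).isW1p
          (((hg (φ i.1)).add (hg (φ i.2))).const_mul (1 / 2)))
      have h3 : (max 0
        (m * nrm q (fun x => 1 / 2 * (U (φ i.1) x + U (φ i.2) x)) ^ 2 -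
          l * nrm p (fun x => 1 / 2 * (U (φ i.1) x + U (φ i.2) x)) ^ 2)) ^ (p / 2) ≤
          nrm p (fun x => 1 / 2 * (g (φ i.1) x + g (φ i.2) x)) ^ p := by
        rw [← sq_rpow_half (nrm_nonneg _ _)]
        apply Real.rpow_le_rpow (le_max_left _ _) _ (by positivity)
        exact max_le (sq_nonneg _) (by linarith)
      linarith
    have h4 := (h0.rpow_const (p := p⁻¹) (Or.inr (by positivity))).const_mul 2
    rw [Real.zero_rpow (by positivity), mul_zero] at h4
    refine h4.congr fun i => ?_
    rw [← Real.rpow_mul (nrm_nonneg _ _), mul_inv_cancel₀ p0.ne', Real.rpow_one, nrm_smul p0,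
      abs_of_pos (by norm_num)]
    ring
  obtain ⟨G, hG, hgG⟩ := exists_tendsto_of_cauchy p1 (fun n => hg (φ n)) hcauchy
  have hUF0 : Tendsto (fun n => nrm p (fun x => U (φ n) x + -1 * F x)) atTop (𝓝 0) :=
    squeeze_zero (fun _ => nrm_nonneg _ _) (fun n => nrm_le_of_bound p0 dist_nonneg
      (.of_forall fun x => by rw [neg_one_mul, ← sub_eq_add_neg]; exact hUF n x)) he
  have hFW : IsW1p p F G := ⟨memLp_of_continuous hFc _, hG,
    isWeakDeriv_of_tendsto p1 (fun n => hW (φ n)) (memLp_of_continuous hFc _) hG hUF0 hgG⟩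
  have hGn : Tendsto (fun n => nrm p (g (φ n))) atTop (𝓝 (nrm p G)) := by
    rw [tendsto_iff_dist_tendsto_zero]
    exact squeeze_zero (fun _ => dist_nonneg) (fun n => abs_nrm_sub_le p1 (hg (φ n)) hG) hgG
  have hGD : nrm p G ^ 2 = D := tendsto_nhds_unique (hGn.pow 2) hgl
  refine ⟨F, G, hFW, fun h => ?_, ?_⟩
  · rw [nrm_congr h, nrm_const (by linarith), abs_zero] at hFq
    exact zero_ne_one hFq
  · rw [hGD, hFq]; ring

/-! ### The differential equation of a nonnegative optimal function -/

lemma isPrimitive_of_hasDerivAt {F G : Circ → ℝ} (hG : Continuous G)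
    (h : ∀ t : ℝ, HasDerivAt (fun s : ℝ => F s) (G t) t) : IsPrimitive F G := by
  refine ⟨integrable_of_continuous hG, fun x y => ?_⟩
  have hc : Continuous fun t : ℝ => G t := hG.comp (AddCircle.continuous_mk' _)
  rw [intervalIntegral.integral_eq_sub_of_hasDerivAt (fun t _ => h t) (hc.intervalIntegrable x y)]

lemma IsPrimitive.hasDerivAt {F G : Circ → ℝ} (h : IsPrimitive F G) (hG : Continuous G) (t : ℝ) :
    HasDerivAt (fun s : ℝ => F s) (G t) t := by
  have hc : Continuous fun t : ℝ => G t := hG.comp (AddCircle.continuous_mk' _)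
  have h1 : (fun t : ℝ => F t) = fun t => F ((0 : ℝ) : Circ) + ∫ s in (0 : ℝ)..t, G s := by
    ext t
    rw [← h.sub_eq]; ring
  rw [h1]
  exact (hc.integral_hasStrictDerivAt 0 t).hasDerivAt.const_add _

/-- The duality map `x ↦ |x|^(s-2) x`, the derivative of `|x|^s / s`. -/
noncomputable def dualityMap (s x : ℝ) : ℝ := |x| ^ (s - 2) * x

lemma hasDerivAt_abs_rpow_dualityMap {s : ℝ} (hs : 1 < s) (x : ℝ) :
    HasDerivAt (fun y : ℝ => |y| ^ s) (s * dualityMap s x) x := by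
  have := hasDerivAt_abs_rpow x hs
  rwa [mul_assoc] at this

lemma continuous_dualityMap {s : ℝ} (hs : 1 < s) : Continuous (dualityMap s) := by
  have h1 : Continuous (deriv fun x : ℝ => |x| ^ s) :=
    (contDiff_norm_rpow (E := ℝ) hs).continuous_deriv le_rfl
  have h2 : dualityMap s = fun x => s⁻¹ * deriv (fun x : ℝ => |x| ^ s) x := by
    ext x
    rw [(hasDerivAt_abs_rpow_dualityMap hs x).deriv, inv_mul_cancel_left₀ (by linarith)]
  rw [h2]
  exact continuous_const.mul h1

lemma abs_dualityMap {s : ℝ} (hs : 1 < s) (x : ℝ) : |dualityMap s x| = |x| ^ (s - 1) := by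
  rcases eq_or_ne x 0 with rfl | hx
  · simp [dualityMap, Real.zero_rpow (by linarith : s - 1 ≠ 0)]
  · rw [dualityMap, abs_mul, abs_of_nonneg (Real.rpow_nonneg (abs_nonneg x) _)]
    nth_rw 2 [← Real.rpow_one |x|]
    rw [← Real.rpow_add (abs_pos.2 hx)]
    congr 1; ring

lemma dualityMap_mul_self {s : ℝ} (hs : 1 < s) (x : ℝ) : dualityMap s x * x = |x| ^ s := by
  rcases eq_or_ne x 0 with rfl | hx
  · simp [Real.zero_rpow (by linarith : s ≠ 0)]
  · rw [dualityMap, mul_assoc, ← abs_mul_abs_self x, ← mul_assoc]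
    nth_rw 2 3 [← Real.rpow_one |x|]
    rw [← Real.rpow_add (abs_pos.2 hx), ← Real.rpow_add (abs_pos.2 hx)]
    congr 1; ring

/-- Duality maps of conjugate exponents are inverse to each other. -/
lemma dualityMap_dualityMap {r s : ℝ} (h : r.HolderConjugate s) (x : ℝ) :
    dualityMap s (dualityMap r x) = x := by
  have hr := h.lt
  rcases eq_or_ne x 0 with rfl | hx
  · simp [dualityMap]
  · rw [dualityMap, abs_dualityMap hr, dualityMap, ← mul_assoc, ← Real.rpow_mul (abs_nonneg x),
      ← Real.rpow_add (abs_pos.2 hx)]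
    have : (r - 1) * (s - 2) + (r - 2) = 0 := by
      have := h.sub_one_mul_conj
      linarith
    rw [this, Real.rpow_zero, one_mul]

/-- The first order form of the equation `(|f'|^(p-2) f')' = α f^(p-1) - β f^(q-1)` for a
nonnegative function on the circle, with `W = |f'|^(p-2) f'`; the exponent `s` is conjugate
to `p`. -/
structure IsSolution (p q s α β : ℝ) (f W : Circ → ℝ) : Prop where
  nonneg : ∀ x, 0 ≤ f x
  hasDerivAt_fst : ∀ t : ℝ, HasDerivAt (fun y : ℝ => f y) (dualityMap s (W t)) t
  hasDerivAt_snd : ∀ t : ℝ, HasDerivAt (fun y : ℝ => W y)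
    (α * f t ^ (p - 1) - β * f t ^ (q - 1)) t

namespace IsSolution

variable {p q s α β : ℝ} {f W : Circ → ℝ}

lemma continuous_fst (h : IsSolution p q s α β f W) : Continuous f :=
  continuous_of_lift (continuous_iff_continuousAt.2 fun t => (h.hasDerivAt_fst t).continuousAt)

lemma continuous_snd (h : IsSolution p q s α β f W) : Continuous W :=
  continuous_of_lift (continuous_iff_continuousAt.2 fun t => (h.hasDerivAt_snd t).continuousAt)

/-- A solution which vanishes somewhere vanishes identically: the energy of the solution is zero,
so that `|f'| ≤ C f`, and Gronwall's inequality applies. -/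
lemma eq_zero (hp : 1 < p) (hpq : p < q) (hs : p.HolderConjugate s) (hα : 0 ≤ α) (hβ : 0 ≤ β)
    (h : IsSolution p q s α β f W) {x₀ : Circ} (h0 : f x₀ = 0) (x : Circ) : f x = 0 := by
  have hs1 := hs.symm.lt
  obtain ⟨a, rfl⟩ := QuotientAddGroup.mk_surjective x₀
  change f (a : Circ) = 0 at h0
  -- at a minimum the derivative vanishes
  have hW0 : W (a : Circ) = 0 := by
    have hmin : IsLocalMin (fun y : ℝ => f y) a :=
      .of_forall fun y => by simp only [h0]; exact h.nonneg _
    have h1 := hmin.hasDerivAt_eq_zero (h.hasDerivAt_fst a)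
    rw [← dualityMap_dualityMap hs.symm (W (a : Circ)), h1]
    simp [dualityMap]
  set E : ℝ → ℝ := fun t => |W t| ^ s / s - α * (f t ^ p / p) + β * (f t ^ q / q)
  have hE : ∀ t, HasDerivAt E 0 t := by
    intro t
    have h1 := (hasDerivAt_abs_rpow_dualityMap hs1 (W t)).comp t (h.hasDerivAt_snd t)
    have h2 := (h.hasDerivAt_fst t).rpow_const (p := p) (Or.inr hp.le)
    have h3 := (h.hasDerivAt_fst t).rpow_const (p := q) (Or.inr (by linarith))
    refine (((h1.div_const s).sub ((h2.div_const p).const_mul α)).add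
      ((h3.div_const q).const_mul β)).congr_deriv ?_
    have : p ≠ 0 := by linarith
    have : q ≠ 0 := by linarith
    have : s ≠ 0 := by linarith
    field_simp
    ring
  have hE0 : ∀ t, E t = 0 := fun t => by
    rw [is_const_of_deriv_eq_zero (fun t => (hE t).differentiableAt) (fun t => (hE t).deriv) t a]
    simp [E, h0, hW0, Real.zero_rpow (by linarith : p ≠ 0), Real.zero_rpow (by linarith : q ≠ 0),
      Real.zero_rpow (by linarith : s ≠ 0)]
  set C := (s * (α / p)) ^ p⁻¹
  have hbound : ∀ t : ℝ, ‖dualityMap s (W t)‖ ≤ C * ‖f t‖ := by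
    intro t
    rw [Real.norm_eq_abs, Real.norm_eq_abs, abs_dualityMap hs1, abs_of_nonneg (h.nonneg _)]
    have h1 : |W t| ^ s ≤ s * (α / p) * f t ^ p := by
      have h2 := hE0 t
      simp only [E] at h2
      have h3 : 0 ≤ β * (f t ^ q / q) :=
        mul_nonneg hβ (div_nonneg (Real.rpow_nonneg (h.nonneg _) _) (by linarith))
      have h4 : |W t| ^ s / s ≤ α * (f t ^ p / p) := by linarith
      rw [div_le_iff₀ (by linarith)] at h4
      calc _ ≤ _ := h4
        _ = _ := by ring
    have h5 := Real.rpow_le_rpow (Real.rpow_nonneg (abs_nonneg _) _) h1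
      (inv_nonneg.2 (by linarith : 0 ≤ p))
    rw [← Real.rpow_mul (abs_nonneg _), Real.mul_rpow (mul_nonneg (by linarith)
      (div_nonneg hα (by linarith))) (Real.rpow_nonneg (h.nonneg _) _),
      ← Real.rpow_mul (h.nonneg _), mul_inv_cancel₀ (by linarith), Real.rpow_one] at h5
    have h6 : s * p⁻¹ = s - 1 := by
      have := hs.symm.sub_one_mul_conj
      have : p ≠ 0 := by linarith
      field_simp
      linarith
    rwa [h6] at h5
  set b : ℝ := (AddCircle.equivIco (2 * Real.pi) a x : ℝ)
  have hb : b ∈ Set.Ico a (a + 2 * Real.pi) := (AddCircle.equivIco (2 * Real.pi) a x).2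
  have hx : (b : Circ) = x := (AddCircle.equivIco (2 * Real.pi) a).symm_apply_apply x
  rw [← hx]
  exact eq_zero_of_abs_deriv_le_mul_abs_self_of_eq_zero_right (f := fun y : ℝ => f y)
    (h.continuous_fst.comp (AddCircle.continuous_mk' _)).continuousOn
    (fun t _ => (h.hasDerivAt_fst t).hasDerivWithinAt) h0 (fun t _ => hbound t) b
    ⟨hb.1, le_rfl⟩

/-- The right-hand side of the equation. -/
lemma continuous_rhs (hp : 1 < p) (hpq : p < q) (h : IsSolution p q s α β f W) :
    Continuous fun x => α * f x ^ (p - 1) - β * f x ^ (q - 1) := by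
  have := h.continuous_fst
  exact (continuous_const.mul (this.rpow_const fun _ => Or.inr (by linarith))).sub
    (continuous_const.mul (this.rpow_const fun _ => Or.inr (by linarith)))

lemma isPrimitive_snd (hp : 1 < p) (hpq : p < q) (h : IsSolution p q s α β f W) :
    IsPrimitive W fun x => α * f x ^ (p - 1) - β * f x ^ (q - 1) :=
  isPrimitive_of_hasDerivAt (h.continuous_rhs hp hpq) h.hasDerivAt_snd

lemma integral_mul_rhs (hp : 1 < p) (hpq : p < q) (hs : p.HolderConjugate s)
    (h : IsSolution p q s α β f W) :
    ∫ x, f x * (α * f x ^ (p - 1) - β * f x ^ (q - 1)) ∂sigma = - ∫ x, |W x| ^ s ∂sigma := by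
  have hs1 := hs.symm.lt
  have c1 : Continuous fun x => |W x| ^ s :=
    h.continuous_snd.abs.rpow_const fun _ => Or.inr (by linarith)
  have c2 : Continuous fun x => f x * (α * f x ^ (p - 1) - β * f x ^ (q - 1)) :=
    h.continuous_fst.mul (h.continuous_rhs hp hpq)
  have h1 : IsPrimitive (fun x => f x * W x) (fun x => |W x| ^ s +
      f x * (α * f x ^ (p - 1) - β * f x ^ (q - 1))) :=
    isPrimitive_of_hasDerivAt (c1.add c2) fun t => by
      refine ((h.hasDerivAt_fst t).mul (h.hasDerivAt_snd t)).congr_deriv ?_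
      rw [dualityMap_mul_self hs1]
  have h2 := h1.integral_eq_zero
  rw [integral_add (integrable_of_continuous c1) (integrable_of_continuous c2)] at h2
  linarith

/-- The carré du champ identity: the equation is multiplied by
`f^(2-p) (W' + (q+1-p) |f'|^p / f)` and integrated by parts. -/
lemma integral_identity (hp : 1 < p) (hpq : p < q) (hs : p.HolderConjugate s)
    (h : IsSolution p q s α β f W) (hpos : ∀ x, 0 < f x) :
    ∫ x, f x ^ (2 - p) * (α * f x ^ (p - 1) - β * f x ^ (q - 1)) ^ 2 ∂sigma +
      (q + 1 - p) * (p - 1) / (s + 1) * ∫ x, f x ^ (-p) * (|W x| ^ s) ^ 2 ∂sigma =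
      α * (q - p) * ∫ x, |W x| ^ s ∂sigma := by
  have hs1 := hs.symm.lt
  have cf := h.continuous_fst
  have cfr : ∀ r : ℝ, Continuous fun x => f x ^ r := fun r =>
    cf.rpow_const fun x => Or.inl (hpos x).ne'
  have cP : Continuous fun x => |W x| ^ s :=
    h.continuous_snd.abs.rpow_const fun _ => Or.inr (by linarith)
  have ch := h.continuous_rhs hp hpq
  have c1 : Continuous fun x => f x ^ (2 - p) * (α * f x ^ (p - 1) - β * f x ^ (q - 1)) ^ 2 :=
    (cfr (2 - p)).mul (ch.pow 2)
  have c2 : Continuous fun x =>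
      (q + 1 - p) * (p - 1) / (s + 1) * (f x ^ (-p) * (|W x| ^ s) ^ 2) :=
    continuous_const.mul ((cfr (-p)).mul (cP.pow 2))
  have c3 : Continuous fun x => α * (q - p) * |W x| ^ s := continuous_const.mul cP
  have h1 : IsPrimitive
      (fun x => α * (f x * W x) - β * (f x ^ (q + 1 - p) * W x) -
        (q + 1 - p) / (s + 1) * (f x ^ (1 - p) * (|W x| ^ s * W x)))
      (fun x => (f x ^ (2 - p) * (α * f x ^ (p - 1) - β * f x ^ (q - 1)) ^ 2 +
        (q + 1 - p) * (p - 1) / (s + 1) * (f x ^ (-p) * (|W x| ^ s) ^ 2)) -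
        α * (q - p) * |W x| ^ s) := by
    refine isPrimitive_of_hasDerivAt ((c1.add c2).sub c3) fun t => ?_
    have hf := h.hasDerivAt_fst t
    have hW := h.hasDerivAt_snd t
    have hne := (hpos t).ne'
    have d1 := hf.mul hW
    have d2 := (hf.rpow_const (p := q + 1 - p) (Or.inl hne)).mul hW
    have d3 := (hf.rpow_const (p := 1 - p) (Or.inl hne)).mul
      (((hasDerivAt_abs_rpow_dualityMap hs1 (W t)).comp t hW).mul hW)
    refine (((d1.const_mul α).sub (d2.const_mul β)).sub
      (d3.const_mul ((q + 1 - p) / (s + 1)))).congr_deriv ?_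
    simp only [Function.comp, Pi.mul_apply]
    have e0 := dualityMap_mul_self hs1 (W t)
    set P := |W t| ^ s
    set w := W t
    set G := dualityMap s w
    set y := f t
    have hy : 0 < y := hpos t
    -- all the powers of `y` are expressed through `y`, `y ^ p` and `y ^ q`
    have r1 : y ^ (p - 1) = y ^ p / y := by rw [Real.rpow_sub hy, Real.rpow_one]
    have r2 : y ^ (q - 1) = y ^ q / y := by rw [Real.rpow_sub hy, Real.rpow_one]
    have r3 : y ^ (2 - p) = y ^ 2 / y ^ p := by rw [Real.rpow_sub hy, Real.rpow_two]
    have r4 : y ^ (-p) = (y ^ p)⁻¹ := Real.rpow_neg hy.le p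
    have r5 : y ^ (q + 1 - p) = y ^ q * y / y ^ p := by
      rw [Real.rpow_sub hy, Real.rpow_add hy, Real.rpow_one]
    have r6 : y ^ (q + 1 - p - 1) = y ^ q / y ^ p := by
      rw [← Real.rpow_sub hy]; congr 1; ring
    have r7 : y ^ (1 - p) = y / y ^ p := by rw [Real.rpow_sub hy, Real.rpow_one]
    have r8 : y ^ (1 - p - 1) = (y ^ p)⁻¹ := by rw [← Real.rpow_neg hy.le]; congr 1; ring
    rw [r1, r2, r3, r4, r5, r6, r7, r8]
    have hp0 : y ^ p ≠ 0 := (Real.rpow_pos_of_pos hy p).ne'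
    have hs0 : s + 1 ≠ 0 := by linarith
    rw [← e0]
    field_simp
    ring
  have h2 := h1.integral_eq_zero
  have i1 := integrable_of_continuous c1
  have i2 := integrable_of_continuous c2
  have i3 := integrable_of_continuous c3
  rw [integral_sub (i1.fun_add i2) i3, integral_add i1 i2, integral_const_mul,
    integral_const_mul] at h2
  linarith

end IsSolution

/-! ### The Euler-Lagrange equation -/

lemma hasDerivAt_integral_abs_rpow {r : ℝ} (hr : 1 < r) {f h : Circ → ℝ}
    (hf : MemLp f (ENNReal.ofReal r) sigma) (hh : MemLp h (ENNReal.ofReal r) sigma) :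
    HasDerivAt (fun t : ℝ => ∫ x, |f x + t * h x| ^ r ∂sigma)
      (∫ x, r * dualityMap r (f x) * h x ∂sigma) 0 := by
  have r0 : 0 < r := by linarith
  have hm : ∀ t : ℝ, MemLp (fun x => f x + t * h x) (ENNReal.ofReal r) sigma := fun t =>
    hf.add (hh.const_mul t)
  have hs : MemLp (fun x => |f x| + |h x|) (ENNReal.ofReal r) sigma := hf.abs.add hh.abs
  have key := hasDerivAt_integral_of_dominated_loc_of_deriv_le (μ := sigma) (x₀ := (0 : ℝ))
    (F := fun t x => |f x + t * h x| ^ r)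
    (F' := fun t x => r * dualityMap r (f x + t * h x) * h x)
    (bound := fun x => r * |(|f x| + |h x|)| ^ r) (Metric.ball_mem_nhds 0 one_pos)
    (.of_forall fun t => (integrable_rpow_abs r0 (hm t)).1)
    (integrable_rpow_abs r0 (hm 0))
    ((((continuous_dualityMap hr).comp_aestronglyMeasurable (hm 0).1).const_mul r).mul hh.1)
    (.of_forall fun x t ht => ?_) ((integrable_rpow_abs r0 hs).const_mul r)
    (.of_forall fun x t _ => ?_)
  · simpa using key.2
  · have ht1 : |t| ≤ 1 := by
      rw [Metric.mem_ball, dist_zero_right, Real.norm_eq_abs] at ht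
      exact ht.le
    have hn : 0 ≤ |f x| + |h x| := by positivity
    rw [Real.norm_eq_abs, abs_mul, abs_mul, abs_of_pos r0, abs_dualityMap hr, abs_of_nonneg hn,
      mul_assoc]
    refine mul_le_mul_of_nonneg_left ?_ r0.le
    have h1 : |f x + t * h x| ≤ |f x| + |h x| := by
      refine (abs_add_le _ _).trans (add_le_add le_rfl ?_)
      rw [abs_mul]
      exact mul_le_of_le_one_left (abs_nonneg _) ht1
    calc |f x + t * h x| ^ (r - 1) * |h x|
        ≤ (|f x| + |h x|) ^ (r - 1) * (|f x| + |h x|) := by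
          gcongr
          linarith [abs_nonneg (f x)]
      _ = (|f x| + |h x|) ^ r := by
          rw [← Real.rpow_add_one' hn (by linarith)]
          congr 1; ring
  · have h1 := hasDerivAt_abs_rpow_dualityMap hr (f x + t * h x)
    have h2 : HasDerivAt (fun t : ℝ => f x + t * h x) (h x) t := by
      simpa using ((hasDerivAt_id t).mul_const (h x)).const_add (f x)
    exact h1.comp t h2

lemma hasDerivAt_nrm_sq {r : ℝ} (hr : 1 < r) {f h : Circ → ℝ}
    (hf : MemLp f (ENNReal.ofReal r) sigma) (hh : MemLp h (ENNReal.ofReal r) sigma)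
    (hpos : 0 < nrm r f) :
    HasDerivAt (fun t : ℝ => nrm r (fun x => f x + t * h x) ^ 2)
      (2 * (nrm r f ^ (2 - r) * ∫ x, dualityMap r (f x) * h x ∂sigma)) 0 := by
  have r0 : 0 < r := by linarith
  have e : ∀ g : Circ → ℝ, nrm r g ^ 2 = (∫ x, |g x| ^ r ∂sigma) ^ (2 / r) := fun g => by
    rw [← nrm_rpow r0, ← Real.rpow_mul (nrm_nonneg r g), mul_div_cancel₀ _ r0.ne', Real.rpow_two]
  simp_rw [e]
  have e0 : ∫ x, |f x + 0 * h x| ^ r ∂sigma = nrm r f ^ r := by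
    rw [nrm_rpow r0]; simp
  have h1 := (hasDerivAt_integral_abs_rpow hr hf hh).rpow_const (p := 2 / r)
    (Or.inl (by rw [e0]; exact (Real.rpow_pos_of_pos hpos r).ne'))
  refine h1.congr_deriv ?_
  rw [e0, ← Real.rpow_mul hpos.le, show r * (2 / r - 1) = 2 - r by field_simp]
  simp_rw [mul_assoc]
  rw [integral_const_mul]
  field_simp

/-- The Euler-Lagrange equation of the interpolation inequality, in weak form. -/
lemma euler_lagrange {p q l : ℝ} (hp : 2 < p) (hpq : p < q) (hl : 0 ≤ l)
    {u du φ ψ : Circ → ℝ} (hu : IsW1p p u du) (hφ : IsW1p p φ ψ)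
    (hmin : nrm p du ^ 2 + l * nrm p u ^ 2 = mu p q l * nrm q u ^ 2)
    (hA : 0 < nrm p du) (hB : 0 < nrm p u) (hC : 0 < nrm q u) :
    nrm p du ^ (2 - p) * ∫ x, dualityMap p (du x) * ψ x ∂sigma =
      mu p q l * (nrm q u ^ (2 - q) * ∫ x, dualityMap q (u x) * φ x ∂sigma) -
      l * (nrm p u ^ (2 - p) * ∫ x, dualityMap p (u x) * φ x ∂sigma) := by
  have p1 : 1 < p := by linarith
  have q1 : 1 < q := by linarith
  have iu : Integrable u sigma := hu.memLp.integrable (by simpa using p1.le)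
  have idu : Integrable du sigma := hu.memLp_deriv.integrable (by simpa using p1.le)
  have iφ : Integrable φ sigma := hφ.memLp.integrable (by simpa using p1.le)
  have iψ : Integrable ψ sigma := hφ.memLp_deriv.integrable (by simpa using p1.le)
  have d1 := hasDerivAt_nrm_sq p1 hu.memLp_deriv hφ.memLp_deriv hA
  have d2 := (hasDerivAt_nrm_sq p1 hu.memLp hφ.memLp hB).const_mul l
  have d3 := (hasDerivAt_nrm_sq q1 (hu.memLp_of_two_le hp.le _) (hφ.memLp_of_two_le hp.le _)
    hC).const_mul (mu p q l)
  have d := (d1.add d2).sub d3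
  have hloc : IsLocalMin (((fun t : ℝ => nrm p (fun x => du x + t * ψ x) ^ 2) +
      fun t : ℝ => l * nrm p (fun x => u x + t * φ x) ^ 2) -
      fun t : ℝ => mu p q l * nrm q (fun x => u x + t * φ x) ^ 2) 0 := by
    refine .of_forall fun t => ?_
    have hw : IsW1p p (fun x => u x + t * φ x) (fun x => du x + t * ψ x) :=
      ⟨hu.memLp.add (hφ.memLp.const_mul t), hu.memLp_deriv.add (hφ.memLp_deriv.const_mul t),
        hu.weakDeriv.add (hφ.weakDeriv.const_mul t) iu idu (iφ.const_mul t) (iψ.const_mul t)⟩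
    have h1 := mu_mul_le hp hpq hl hw
    simp only [Pi.sub_apply, Pi.add_apply, zero_mul, add_zero]
    linarith
  have := hloc.hasDerivAt_eq_zero d
  linarith

/-- Integration by parts for two primitives. -/
lemma IsPrimitive.integral_mul {U g W h : Circ → ℝ} (hU : IsPrimitive U g)
    (hW : IsPrimitive W h) : ∫ x, U x * h x ∂sigma = - ∫ x, g x * W x ∂sigma := by
  have key := (hU.absolutelyContinuous 0 (0 + 2 * Real.pi)).integral_mul_deriv_eq_deriv_mul
    (hW.absolutelyContinuous 0 (0 + 2 * Real.pi))
  have e1 : ∫ t in (0 : ℝ)..0 + 2 * Real.pi, U t * deriv (fun t : ℝ => W t) t =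
      ∫ t in (0 : ℝ)..0 + 2 * Real.pi, U t * h t := by
    apply intervalIntegral.integral_congr_ae
    filter_upwards [hW.ae_hasDerivAt] with t ht _
    rw [ht.deriv]
  have e2 : ∫ t in (0 : ℝ)..0 + 2 * Real.pi, deriv (fun t : ℝ => U t) t * W t =
      ∫ t in (0 : ℝ)..0 + 2 * Real.pi, g t * W t := by
    apply intervalIntegral.integral_congr_ae
    filter_upwards [hU.ae_hasDerivAt] with t ht _
    rw [ht.deriv]
  rw [e1, e2] at key
  rw [integral_sigma _ 0, integral_sigma _ 0, key, AddCircle.coe_add_period]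
  ring

/-- The lemma of du Bois-Reymond: if `∫ w φ' = - ∫ h φ` for the primitives `φ` of all bounded
functions with mean zero, then `w` is a primitive of `h`. -/
lemma exists_isPrimitive_of_weak {w h : Circ → ℝ} (hw : Integrable w sigma)
    (hh : Integrable h sigma)
    (H : ∀ φ ψ : Circ → ℝ, IsPrimitive φ ψ → (∀ r, MemLp ψ r sigma) →
      ∫ x, w x * ψ x ∂sigma = - ∫ x, h x * φ x ∂sigma) :
    ∃ W : Circ → ℝ, IsPrimitive W h ∧ w =ᵐ[sigma] W := by
  have h0 : ∫ x, h x ∂sigma = 0 := by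
    have := H _ _ (isPrimitive_const 1) (fun r => MemLp.zero')
    simpa using this.symm
  obtain ⟨W₀, hW₀, -⟩ := exists_isPrimitive hh h0 0
  have iW₀ := integrable_of_continuous hW₀.continuous
  set c := ∫ x, (w x - W₀ x) ∂sigma
  have hd : Integrable (fun x => w x - W₀ x) sigma := hw.sub iW₀
  have key : (fun x => w x - W₀ x) =ᵐ[sigma] fun _ => c := by
    refine Integrable.ae_eq_of_forall_setIntegral_eq _ _ hd (integrable_const c) fun s hs _ => ?_
    -- the derivative of the test function is the indicator of `s`, made mean free
    set b := sigma.real s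
    have mind : ∀ r, MemLp (s.indicator fun _ => (1 : ℝ)) r sigma := fun r =>
      memLp_indicator_const r hs 1 (Or.inr (measure_ne_top _ _))
    have mψ : ∀ r, MemLp (fun x => s.indicator (fun _ => (1 : ℝ)) x - b) r sigma := fun r =>
      (mind r).sub (memLp_const b)
    have iind : Integrable (s.indicator fun _ => (1 : ℝ)) sigma := (mind 1).integrable le_rfl
    have hψ0 : ∫ x, (s.indicator (fun _ => (1 : ℝ)) x - b) ∂sigma = 0 := by
      rw [integral_sub iind (integrable_const b), integral_indicator hs]
      simp [b]
    obtain ⟨φ, hφ, -⟩ := exists_isPrimitive ((mψ 1).integrable le_rfl) hψ0 0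
    have h1 := H φ _ hφ mψ
    have h2 := hφ.integral_mul hW₀
    have h3 : ∫ x, h x * φ x ∂sigma = ∫ x, φ x * h x ∂sigma := by simp_rw [mul_comm]
    rw [h3, h2, neg_neg] at h1
    have e : ∀ {a : Circ → ℝ}, Integrable a sigma →
        ∫ x, a x * (s.indicator (fun _ => (1 : ℝ)) x - b) ∂sigma =
        ∫ x in s, a x ∂sigma - b * ∫ x, a x ∂sigma := by
      intro a ha
      have e1 : ∀ x, a x * (s.indicator (fun _ => (1 : ℝ)) x - b) = s.indicator a x - b * a x := by
        intro x
        by_cases hx : x ∈ s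
        · simp [hx]; ring
        · simp [hx]; ring
      simp_rw [e1]
      rw [integral_sub (ha.indicator hs) (ha.const_mul b), integral_indicator hs,
        integral_const_mul]
    have h4 : ∫ x, (s.indicator (fun _ => (1 : ℝ)) x - b) * W₀ x ∂sigma =
        ∫ x, W₀ x * (s.indicator (fun _ => (1 : ℝ)) x - b) ∂sigma := by simp_rw [mul_comm]
    rw [h4, e hw, e iW₀] at h1
    rw [integral_sub hw.integrableOn iW₀.integrableOn, setIntegral_const, smul_eq_mul]
    have h5 : c = ∫ x, w x ∂sigma - ∫ x, W₀ x ∂sigma := integral_sub hw iW₀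
    rw [h5]
    simp only [b] at h1
    linarith
  refine ⟨fun x => W₀ x + c, ⟨hh, fun x y => ?_⟩, ?_⟩
  · rw [← hW₀.sub_eq]; ring
  · filter_upwards [key] with x hx
    linarith

/-- A nonnegative optimal function solves the Euler-Lagrange equation in the classical sense. -/
lemma exists_isSolution {p q s l : ℝ} (hp : 2 < p) (hpq : p < q) (hs : p.HolderConjugate s)
    (hl : 0 ≤ l) {u du : Circ → ℝ} (hu : IsPrimitive u du)
    (hdu : MemLp du (ENNReal.ofReal p) sigma) (hnn : ∀ x, 0 ≤ u x)
    (hmin : nrm p du ^ 2 + l * nrm p u ^ 2 = mu p q l * nrm q u ^ 2)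
    (hA : 0 < nrm p du) (hB : 0 < nrm p u) (hC : 0 < nrm q u) :
    ∃ (β : ℝ) (W : Circ → ℝ), 0 ≤ β ∧
      IsSolution p q s (nrm p du ^ (p - 2) * (l * nrm p u ^ (2 - p))) β u W ∧
      ∀ᵐ x ∂sigma, |W x| ^ s = |du x| ^ p := by
  have p1 : 1 < p := by linarith
  set α := nrm p du ^ (p - 2) * (l * nrm p u ^ (2 - p))
  set β := nrm p du ^ (p - 2) * (mu p q l * nrm q u ^ (2 - q))
  have hβ : 0 ≤ β := by
    have := mu_nonneg hp hpq hl
    positivity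
  have hdual : ∀ {r x : ℝ}, 1 < r → 0 ≤ x → dualityMap r x = x ^ (r - 1) := fun {r x} hr hx => by
    rw [← abs_of_nonneg (a := dualityMap r x) (mul_nonneg (Real.rpow_nonneg (abs_nonneg _) _) hx),
      abs_dualityMap hr, abs_of_nonneg hx]
  have cpow : ∀ r : ℝ, 1 < r → Continuous fun x => u x ^ (r - 1) := fun r hr =>
    hu.continuous.rpow_const fun _ => Or.inr (by linarith)
  have crhs : Continuous fun x => α * u x ^ (p - 1) - β * u x ^ (q - 1) :=
    (continuous_const.mul (cpow p p1)).sub (continuous_const.mul (cpow q (by linarith)))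
  have hwint : Integrable (fun x => dualityMap p (du x)) sigma := by
    have h1 : Integrable (fun x => |du x| ^ (p - 1)) sigma :=
      integrable_rpow_abs (by linarith) (hdu.mono_exponent (ENNReal.ofReal_le_ofReal (by linarith)))
    refine h1.mono ((continuous_dualityMap p1).comp_aestronglyMeasurable hdu.1)
      (.of_forall fun x => ?_)
    rw [Real.norm_eq_abs, Real.norm_eq_abs, abs_dualityMap p1,
      abs_of_nonneg (Real.rpow_nonneg (abs_nonneg _) _)]
  obtain ⟨W, hW, hwW⟩ := exists_isPrimitive_of_weak hwint (integrable_of_continuous crhs) (by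
    intro φ ψ hφ hψ
    have h1 := euler_lagrange hp hpq hl (hu.isW1p hdu) (hφ.isW1p (hψ _)) hmin hA hB hC
    have e : ∀ r, 1 < r → ∫ x, dualityMap r (u x) * φ x ∂sigma =
        ∫ x, u x ^ (r - 1) * φ x ∂sigma := fun r hr => by
      simp_rw [hdual hr (hnn _)]
    rw [e p p1, e q (by linarith)] at h1
    have i : ∀ r : ℝ, 1 < r → Integrable (fun x => u x ^ (r - 1) * φ x) sigma := fun r hr =>
      integrable_of_continuous ((cpow r hr).mul hφ.continuous)
    have e2 : ∀ x, (α * u x ^ (p - 1) - β * u x ^ (q - 1)) * φ x =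
        α * (u x ^ (p - 1) * φ x) - β * (u x ^ (q - 1) * φ x) := fun x => by ring
    simp_rw [e2]
    rw [integral_sub ((i p p1).const_mul α) ((i q (by linarith)).const_mul β), integral_const_mul,
      integral_const_mul]
    have h2 : nrm p du ^ (p - 2) * nrm p du ^ (2 - p) = 1 := by
      rw [← Real.rpow_add hA]; simp
    have h3 := congrArg (nrm p du ^ (p - 2) * ·) h1
    rw [← mul_assoc, h2, one_mul] at h3
    rw [h3]
    simp only [α, β]
    ring)
  have hduW : du =ᵐ[sigma] fun x => dualityMap s (W x) := by
    filter_upwards [hwW] with x hx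
    rw [← hx, dualityMap_dualityMap hs]
  have cG : Continuous fun x => dualityMap s (W x) :=
    (continuous_dualityMap hs.symm.lt).comp hW.continuous
  have hu' : IsPrimitive u fun x => dualityMap s (W x) := by
    refine ⟨integrable_of_continuous cG, fun x y => ?_⟩
    rw [hu.sub_eq]
    apply intervalIntegral.integral_congr_ae
    filter_upwards [ae_lift hduW] with t ht _
    exact ht
  refine ⟨β, W, hβ, ⟨hnn, hu'.hasDerivAt cG, hW.hasDerivAt crhs⟩, ?_⟩
  filter_upwards [hwW] with x hx
  rw [← hx, abs_dualityMap p1, ← Real.rpow_mul (abs_nonneg _), hs.sub_one_mul_conj]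

/-! ### Rigidity of nonnegative optimal functions -/

lemma lambda1_mul_le {p : ℝ} (hp : 0 < p) {v dv : Circ → ℝ} (hv : IsW1p p v dv)
    (h0 : ∫ x, v x ∂sigma = 0) : lambda1 p * nrm p v ^ 2 ≤ nrm p dv ^ 2 := by
  by_cases hz : NonZero v
  · have hpos := nrm_pos hp hv.memLp hz
    rw [← le_div_iff₀ (by positivity)]
    refine csInf_le ⟨0, ?_⟩ ⟨v, dv, hv, hz, h0, rfl⟩
    rintro t ⟨w, dw, -, -, -, rfl⟩
    exact div_nonneg (sq_nonneg _) (sq_nonneg _)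
  · rw [nrm_eq_zero_of_not_nonZero hp hz]
    simpa using sq_nonneg _

/-- A form of the Poincaré inequality for the second derivative of a solution. The gradient term
is written as `- ∫ (f - ∫ f) W'`, and the inequalities of Cauchy-Schwarz, Hölder and Poincaré are
applied in turn. -/
lemma IsSolution.poincare {p q s α β : ℝ} {f W du : Circ → ℝ} (hp : 2 < p) (hpq : p < q)
    (hs : p.HolderConjugate s) (hl : 0 ≤ lambda1 p) (h : IsSolution p q s α β f W)
    (hpos : ∀ x, 0 < f x) (hdu : MemLp du (ENNReal.ofReal p) sigma) (hf : IsPrimitive f du)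
    (hWdu : ∀ᵐ x ∂sigma, |W x| ^ s = |du x| ^ p) :
    lambda1 p * (nrm p du ^ p) ^ 2 ≤ (∫ x, f x ^ (2 - p) *
      (α * f x ^ (p - 1) - β * f x ^ (q - 1)) ^ 2 ∂sigma) * nrm p f ^ (p - 2) * nrm p du ^ 2 := by
  have p0 : 0 < p := by linarith
  have p1 : 1 < p := by linarith
  set k := fun x => α * f x ^ (p - 1) - β * f x ^ (q - 1)
  have ck : Continuous k := h.continuous_rhs p1 hpq
  have cf := h.continuous_fst
  have cfr : ∀ r : ℝ, Continuous fun x => f x ^ r := fun r =>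
    cf.rpow_const fun x => Or.inl (hpos x).ne'
  set m := ∫ x, f x ∂sigma
  have cv : Continuous fun x => f x - m := cf.sub continuous_const
  -- the gradient term
  have h1 : nrm p du ^ p = - ∫ x, (f x - m) * k x ∂sigma := by
    have e1 : ∫ x, |W x| ^ s ∂sigma = ∫ x, |du x| ^ p ∂sigma := integral_congr_ae hWdu
    have e2 := h.integral_mul_rhs p1 hpq hs
    have e3 : ∫ x, k x ∂sigma = 0 := (h.isPrimitive_snd p1 hpq).integral_eq_zero
    simp_rw [sub_mul]
    rw [integral_sub (integrable_of_continuous (cf.fun_mul ck))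
      (integrable_of_continuous (continuous_const.fun_mul ck)), integral_const_mul, e3,
      nrm_rpow p0, ← e1]
    simp only [k]
    rw [e2]
    ring
  have h2 : nrm p du ^ p ≤ nrm 2 (fun x => f x ^ ((2 - p) / 2) * k x) *
      nrm 2 (fun x => f x ^ ((p - 2) / 2) * (f x - m)) := by
    have c1 : Continuous fun x => f x ^ ((2 - p) / 2) * k x := (cfr _).mul ck
    have c2 : Continuous fun x => f x ^ ((p - 2) / 2) * (f x - m) := (cfr _).mul cv
    refine le_trans ?_ (integral_abs_mul_le Real.HolderConjugate.two_two
      (memLp_of_continuous c1 _) (memLp_of_continuous c2 _))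
    rw [h1, ← integral_neg]
    apply integral_mono (integrable_of_continuous (cv.fun_mul ck).fun_neg)
      (integrable_of_continuous (c1.abs.fun_mul c2.abs))
    intro x
    simp only
    rw [← abs_mul]
    refine (neg_le_abs _).trans (le_of_eq ?_)
    congr 1
    have : f x ^ ((2 - p) / 2) * f x ^ ((p - 2) / 2) = 1 := by
      rw [← Real.rpow_add (hpos x), ← add_div]; simp
    linear_combination (-(f x - m) * k x) * this
  have hsq : ∀ (r : ℝ) (g : Circ → ℝ), nrm 2 (fun x => f x ^ (r / 2) * g x) ^ 2 =
      ∫ x, f x ^ r * g x ^ 2 ∂sigma := by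
    intro r g
    rw [← Real.rpow_two, nrm_rpow two_pos]
    refine integral_congr_ae (.of_forall fun x => ?_)
    simp only [Real.rpow_two, sq_abs]
    rw [mul_pow, ← Real.rpow_natCast, ← Real.rpow_mul (hpos x).le]
    congr 2; push_cast; ring
  have h3 : (nrm p du ^ p) ^ 2 ≤ (∫ x, f x ^ (2 - p) * k x ^ 2 ∂sigma) *
      ∫ x, f x ^ (p - 2) * (f x - m) ^ 2 ∂sigma := by
    rw [← hsq, ← hsq, ← mul_pow]
    exact pow_le_pow_left₀ (Real.rpow_nonneg (nrm_nonneg _ _) _) h2 2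
  have h4 : ∫ x, f x ^ (p - 2) * (f x - m) ^ 2 ∂sigma ≤
      nrm p f ^ (p - 2) * nrm p (fun x => f x - m) ^ 2 := by
    have hconj : (p / (p - 2)).HolderConjugate (p / 2) := by
      rw [Real.holderConjugate_iff]
      constructor
      · rw [lt_div_iff₀ (by linarith)]; linarith
      · field_simp; ring
    have c1 : Continuous fun x => |f x| ^ (p - 2) := cf.abs.rpow_const fun _ => Or.inr (by linarith)
    have c2 : Continuous fun x => |f x - m| ^ (2 : ℝ) :=
      cv.abs.rpow_const fun _ => Or.inr (by norm_num)
    have e := integral_abs_mul_le hconj (memLp_of_continuous c1 _) (memLp_of_continuous c2 _)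
    rw [nrm_rpow_abs (div_pos p0 (by linarith)) (by linarith),
      nrm_rpow_abs (f := fun x => f x - m) (by linarith) two_pos,
      div_mul_cancel₀ _ (by linarith : p - 2 ≠ 0), div_mul_cancel₀ _ two_ne_zero,
      Real.rpow_two] at e
    refine le_trans (le_of_eq (integral_congr_ae (.of_forall fun x => ?_))) e
    simp only
    rw [abs_of_pos (hpos x), abs_of_nonneg (Real.rpow_nonneg (hpos x).le _),
      Real.rpow_two, sq_abs, abs_of_nonneg (sq_nonneg _)]
  have h5 : lambda1 p * nrm p (fun x => f x - m) ^ 2 ≤ nrm p du ^ 2 := by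
    have hv : IsPrimitive (fun x => f x - m) du :=
      ⟨hf.integrable, fun x y => by rw [← hf.sub_eq]; ring⟩
    refine lambda1_mul_le p0 (hv.isW1p hdu) ?_
    rw [integral_sub (integrable_of_continuous cf) (integrable_const m)]
    simp [m]
  have hS : 0 ≤ ∫ x, f x ^ (2 - p) * k x ^ 2 ∂sigma :=
    integral_nonneg fun x => mul_nonneg (Real.rpow_nonneg (hpos x).le _) (sq_nonneg _)
  have hN : 0 ≤ nrm p f ^ (p - 2) := Real.rpow_nonneg (nrm_nonneg _ _) _
  calc lambda1 p * (nrm p du ^ p) ^ 2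
      ≤ lambda1 p * ((∫ x, f x ^ (2 - p) * k x ^ 2 ∂sigma) *
        (nrm p f ^ (p - 2) * nrm p (fun x => f x - m) ^ 2)) :=
        mul_le_mul_of_nonneg_left (h3.trans (mul_le_mul_of_nonneg_left h4 hS)) hl
    _ = (∫ x, f x ^ (2 - p) * k x ^ 2 ∂sigma) * nrm p f ^ (p - 2) *
        (lambda1 p * nrm p (fun x => f x - m) ^ 2) := by ring
    _ ≤ _ := mul_le_mul_of_nonneg_left h5 (mul_nonneg hS hN)

/-- Nonnegative optimal functions are constant when `(q - p) l ≤ λ₁`. -/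
lemma nrm_deriv_eq_zero_of_nonneg {p q l : ℝ} (hp : 2 < p) (hpq : p < q) (hl : 0 ≤ l)
    (hl1 : l * (q - p) ≤ lambda1 p) {u du : Circ → ℝ} (hu : IsPrimitive u du)
    (hdu : MemLp du (ENNReal.ofReal p) sigma) (hnn : ∀ x, 0 ≤ u x) (hnz : NonZero u)
    (hmin : nrm p du ^ 2 + l * nrm p u ^ 2 = mu p q l * nrm q u ^ 2) : nrm p du = 0 := by
  by_contra hA'
  have p0 : 0 < p := by linarith
  have p1 : 1 < p := by linarith
  have hA : 0 < nrm p du := (nrm_nonneg _ _).lt_of_ne' hA'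
  have hB : 0 < nrm p u := nrm_pos p0 (memLp_of_continuous hu.continuous _) hnz
  have hC : 0 < nrm q u := nrm_pos (by linarith) (memLp_of_continuous hu.continuous _) hnz
  have hs : p.HolderConjugate p.conjExponent := .conjExponent p1
  set s := p.conjExponent
  have hs1 := hs.symm.lt
  obtain ⟨β, W, hβ, hsol, hW⟩ := exists_isSolution hp hpq hs hl hu hdu hnn hmin hA hB hC
  set α := nrm p du ^ (p - 2) * (l * nrm p u ^ (2 - p))
  have hα : 0 ≤ α := by positivity
  have hpos : ∀ x, 0 < u x := by
    intro x
    refine (hnn x).lt_of_ne' fun h0 => hnz (.of_forall fun y => ?_)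
    exact hsol.eq_zero p1 hpq hs hα hβ h0 y
  have hl1' : 0 ≤ lambda1 p := (mul_nonneg hl (by linarith)).trans hl1
  have hid := hsol.integral_identity p1 hpq hs hpos
  have hpoin := hsol.poincare hp hpq hs hl1' hpos hdu hu hW
  set S := ∫ x, u x ^ (2 - p) * (α * u x ^ (p - 1) - β * u x ^ (q - 1)) ^ 2 ∂sigma
  have hWint : ∫ x, |W x| ^ s ∂sigma = nrm p du ^ p := by
    rw [nrm_rpow p0]; exact integral_congr_ae hW
  rw [hWint] at hid
  have hR : 0 < ∫ x, u x ^ (-p) * (|W x| ^ s) ^ 2 ∂sigma := by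
    have cR : Continuous fun x => u x ^ (-p) * (|W x| ^ s) ^ 2 :=
      (hu.continuous.rpow_const fun x => Or.inl (hpos x).ne').mul
        ((hsol.continuous_snd.abs.rpow_const fun _ => Or.inr (by linarith)).pow 2)
    have hnn : ∀ x, 0 ≤ u x ^ (-p) * (|W x| ^ s) ^ 2 := fun x =>
      mul_nonneg (Real.rpow_nonneg (hpos x).le _) (sq_nonneg _)
    refine (integral_nonneg hnn).lt_of_ne' fun h0 => ?_
    have h1 := (integral_eq_zero_iff_of_nonneg hnn (integrable_of_continuous cR)).1 h0
    have h2 : ∫ x, |W x| ^ s ∂sigma = 0 := by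
      rw [← integral_zero Circ ℝ (μ := sigma)]
      refine integral_congr_ae ?_
      filter_upwards [h1] with x hx
      simpa [(Real.rpow_pos_of_pos (hpos x) (-p)).ne'] using hx
    rw [hWint] at h2
    exact (Real.rpow_pos_of_pos hA p).ne' h2
  have hS : S < α * (q - p) * nrm p du ^ p := by
    have : 0 < (q + 1 - p) * (p - 1) / (s + 1) :=
      div_pos (mul_pos (by linarith) (by linarith)) (by linarith)
    have := mul_pos this hR
    linarith
  have e1 : nrm p u ^ (2 - p) * nrm p u ^ (p - 2) = 1 := by
    rw [← Real.rpow_add hB]; simp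
  have e2 : nrm p du ^ (p - 2) * nrm p du ^ 2 = nrm p du ^ p := by
    rw [← Real.rpow_two, ← Real.rpow_add hA]; simp
  have hBp : 0 < nrm p u ^ (p - 2) := Real.rpow_pos_of_pos hB _
  have hfin : lambda1 p * (nrm p du ^ p) ^ 2 < l * (q - p) * (nrm p du ^ p) ^ 2 := by
    calc _ ≤ S * nrm p u ^ (p - 2) * nrm p du ^ 2 := hpoin
      _ < α * (q - p) * nrm p du ^ p * nrm p u ^ (p - 2) * nrm p du ^ 2 := by gcongr
      _ = l * (q - p) * (nrm p u ^ (2 - p) * nrm p u ^ (p - 2)) *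
          (nrm p du ^ (p - 2) * nrm p du ^ 2) * nrm p du ^ p := by simp only [α]; ring
      _ = l * (q - p) * (nrm p du ^ p) ^ 2 := by rw [e1, e2]; ring
  have hpp : 0 < (nrm p du ^ p) ^ 2 := by have := Real.rpow_pos_of_pos hA p; positivity
  exact absurd hl1 (not_le.2 (lt_of_mul_lt_mul_right hfin hpp.le))

/-! ### Optimal functions are constant -/

lemma IsPrimitive.eq_of_nrm_eq_zero {p : ℝ} (hp : 0 < p) {U g : Circ → ℝ} (h : IsPrimitive U g)
    (hg : MemLp g (ENNReal.ofReal p) sigma) (h0 : nrm p g = 0) (x : Circ) : U x = U 0 := by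
  obtain ⟨t, rfl⟩ := QuotientAddGroup.mk_surjective x
  have h1 := h.sub_eq 0 t
  have h2 : ∫ s in (0 : ℝ)..t, g s = 0 := by
    apply intervalIntegral.integral_zero_ae
    filter_upwards [ae_lift ((nrm_eq_zero_iff hp hg).1 h0)] with s hs _
    exact hs
  rw [h2] at h1
  exact sub_eq_zero.1 h1

/-- Optimal functions are constant when `(q - p) l ≤ λ₁`. Nonnegativity is not a restriction,
since the absolute value of an optimal function is optimal. -/
theorem rigidity {p q l : ℝ} (hp : 2 < p) (hpq : p < q) (hl : 0 ≤ l)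
    (hl1 : l * (q - p) ≤ lambda1 p) {u du : Circ → ℝ} (h : IsW1p p u du) (hnz : NonZero u)
    (hmin : nrm p du ^ 2 + l * nrm p u ^ 2 = mu p q l * nrm q u ^ 2) :
    mu p q l = l ∧ ∃ c : ℝ, c ≠ 0 ∧ u =ᵐ[sigma] fun _ => c := by
  have p0 : 0 < p := by linarith
  have q0 : 0 < q := by linarith
  obtain ⟨U, hU, he⟩ := h.exists_isPrimitive hp.le
  obtain ⟨g, hg, hle⟩ := hU.exists_abs
  have hgm : MemLp g (ENNReal.ofReal p) sigma := h.memLp_deriv.mono hg.integrable.1 hle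
  have habs : ∀ r, nrm r (fun x => |U x|) = nrm r U := fun r =>
    nrm_congr_abs (.of_forall fun x => abs_abs _)
  have hUnz : NonZero U := fun h0 => hnz (he.trans h0)
  have hAnz : NonZero fun x => |U x| := fun h0 => hUnz (by
    filter_upwards [h0] with x hx
    exact abs_eq_zero.1 hx)
  rw [nrm_congr he, nrm_congr he (r := q)] at hmin
  have hmin' : nrm p g ^ 2 + l * nrm p (fun x => |U x|) ^ 2 =
      mu p q l * nrm q (fun x => |U x|) ^ 2 := by
    refine le_antisymm ?_ (mu_mul_le hp hpq hl (hg.isW1p hgm))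
    rw [habs, habs, ← hmin]
    have := pow_le_pow_left₀ (nrm_nonneg _ _) (nrm_mono_abs p0 h.memLp_deriv hle) 2
    linarith
  have hg0 := nrm_deriv_eq_zero_of_nonneg hp hpq hl hl1 hg hgm (fun x => abs_nonneg _) hAnz hmin'
  have hconst := hg.eq_of_nrm_eq_zero p0 hgm hg0
  set k := |U 0|
  have hk : 0 ≤ k := abs_nonneg _
  have hnk : ∀ r, 0 < r → nrm r U = k := fun r hr => by
    rw [← habs, funext hconst, nrm_const hr, abs_of_nonneg hk]
  have hk0 : k ≠ 0 := fun h0 => hUnz (.of_forall fun x => by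
    have := hconst x
    rw [h0] at this
    exact abs_eq_zero.1 this)
  rw [habs, habs, hnk p p0, hnk q q0, hg0] at hmin'
  have hk2 : k ^ 2 ≠ 0 := pow_ne_zero 2 hk0
  have hmu : mu p q l = l := by
    apply mul_right_cancel₀ hk2
    linarith
  have hdu : nrm p du = 0 := by
    rw [hnk p p0, hnk q q0, hmu] at hmin
    have : nrm p du ^ 2 = 0 := by linarith
    exact pow_eq_zero_iff two_ne_zero |>.1 this
  refine ⟨hmu, U 0, abs_ne_zero.1 hk0, he.trans (.of_forall fun x => ?_)⟩
  exact hU.eq_of_nrm_eq_zero p0 h.memLp_deriv hdu x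

lemma mu_eq_self {p q l : ℝ} (hp : 2 < p) (hpq : p < q) (hl : 0 ≤ l)
    (hl1 : l * (q - p) ≤ lambda1 p) : mu p q l = l := by
  obtain ⟨u, du, h, hnz, hmin⟩ := exists_minimizer hp hpq hl
  exact (rigidity hp hpq hl hl1 h hnz hmin).1

/-! ### The optimal constant as a function of the parameter -/

section

variable {p q : ℝ}

lemma mu_mono (hp : 2 < p) (hpq : p < q) {l l' : ℝ} (hl : 0 ≤ l) (h : l ≤ l') :
    mu p q l ≤ mu p q l' :=
  le_mu hp hpq fun u du hu _ => by
    have h1 := mu_mul_le hp hpq hl hu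
    have h2 := mul_le_mul_of_nonneg_right h (sq_nonneg (nrm p u))
    linarith

/-- The optimal constant is Lipschitz with constant `1`, because `‖u‖_p ≤ ‖u‖_q`. -/
lemma mu_le_add (hp : 2 < p) (hpq : p < q) {l l' : ℝ} (hl : 0 ≤ l) (h : l ≤ l') :
    mu p q l' ≤ mu p q l + (l' - l) := by
  rw [← sub_le_iff_le_add]
  refine le_mu hp hpq fun u du hu _ => ?_
  have h1 := mu_mul_le hp hpq (hl.trans h) hu
  have h2 := nrm_mono_exponent (by linarith) hpq.le (hu.memLp_of_two_le hp.le (ENNReal.ofReal q))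
  have h3 := mul_le_mul_of_nonneg_left (pow_le_pow_left₀ (nrm_nonneg p u) h2 2) (sub_nonneg.2 h)
  linarith

lemma mu_continuousOn (hp : 2 < p) (hpq : p < q) : ContinuousOn (mu p q) (Set.Ici 0) := by
  have key : ∀ l ∈ Set.Ici (0 : ℝ), ∀ l' ∈ Set.Ici (0 : ℝ), l ≤ l' →
      dist (mu p q l) (mu p q l') ≤ dist l l' := by
    intro l hl l' _ h
    have h1 := mu_mono hp hpq hl h
    have h2 := mu_le_add hp hpq hl h
    rw [dist_comm, dist_comm l, Real.dist_eq, Real.dist_eq, abs_of_nonneg (by linarith),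
      abs_of_nonneg (by linarith)]
    linarith
  refine (LipschitzOnWith.of_dist_le_mul (K := 1) fun l hl l' hl' => ?_).continuousOn
  rw [NNReal.coe_one, one_mul]
  rcases le_total l l' with h | h
  · exact key l hl l' hl' h
  · rw [dist_comm, dist_comm l]
    exact key l' hl' l hl h

/-- The optimal constant is an infimum of affine functions of the parameter. -/
lemma mu_concave (hp : 2 < p) (hpq : p < q) {l l' a b : ℝ} (hl : 0 ≤ l) (hl' : 0 ≤ l')
    (ha : 0 ≤ a) (hb : 0 ≤ b) (hab : a + b = 1) :
    a * mu p q l + b * mu p q l' ≤ mu p q (a * l + b * l') :=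
  le_mu hp hpq fun u du hu _ => by
    have h1 := mul_le_mul_of_nonneg_left (mu_mul_le hp hpq hl hu) ha
    have h2 := mul_le_mul_of_nonneg_left (mu_mul_le hp hpq hl' hu) hb
    have h3 : nrm p du ^ 2 = a * nrm p du ^ 2 + b * nrm p du ^ 2 := by rw [← add_mul, hab, one_mul]
    rw [h3]
    linarith

/-- The optimal constant is unbounded: by interpolation and Young's inequality, `‖u‖_q` is at most
a small multiple of `‖u'‖_p` plus a large multiple of `‖u‖_p`. -/
lemma mu_unbounded (hp : 2 < p) (hpq : p < q) {M : ℝ} (hM : 0 ≤ M) :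
    ∃ l, 0 ≤ l ∧ M ≤ mu p q l := by
  have hpi := Real.pi_pos
  have q0 : 0 < q := by linarith
  have p0 : 0 < p := by linarith
  -- `ε` is chosen so that `M * 2 * (2 * π * ε) ^ 2 ≤ 1`
  set ε : ℝ := 1 / (4 * Real.pi * (M + 1)) with hε
  have hε0 : 0 < ε := by positivity
  set K : ℝ := (ε ^ (1 - p / q)) ^ (-(q / p))
  have hK : 0 ≤ K := by positivity
  refine ⟨2 * M * (ε + K) ^ 2, by positivity, le_mu hp hpq fun u du hu _ => ?_⟩
  have hX := hu.nrm_interpolation hp.le hpq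
  set a := nrm p du
  set y := nrm p u
  have ha : 0 ≤ a := nrm_nonneg _ _
  have hy : 0 ≤ y := nrm_nonneg _ _
  have hθ : 0 ≤ 1 - p / q := by rw [sub_nonneg, div_le_one q0]; exact hpq.le
  have hθ' : p / q ≤ 1 := by linarith
  have hyoung := Real.geom_mean_le_arith_mean2_weighted hθ (by positivity : 0 ≤ p / q)
    (mul_nonneg hε0.le (by positivity : 0 ≤ 2 * Real.pi * a + y)) (mul_nonneg hK hy) (by ring)
  rw [Real.mul_rpow hε0.le (by positivity), Real.mul_rpow hK hy] at hyoung
  have hKε : ε ^ (1 - p / q) * K ^ (p / q) = 1 := by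
    simp only [K]
    rw [← Real.rpow_mul (by positivity), show -(q / p) * (p / q) = -1 by field_simp,
      Real.rpow_neg_one]
    exact mul_inv_cancel₀ (Real.rpow_pos_of_pos hε0 _).ne'
  have h1 : nrm q u ≤ 2 * Real.pi * ε * a + (ε + K) * y := by
    calc nrm q u ≤ _ := hX
      _ = ε ^ (1 - p / q) * K ^ (p / q) *
          ((2 * Real.pi * a + y) ^ (1 - p / q) * y ^ (p / q)) := by rw [hKε, one_mul]
      _ = ε ^ (1 - p / q) * (2 * Real.pi * a + y) ^ (1 - p / q) *
          (K ^ (p / q) * y ^ (p / q)) := by ring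
      _ ≤ _ := hyoung
      _ ≤ 1 * (ε * (2 * Real.pi * a + y)) + 1 * (K * y) := by
          gcongr
          linarith [div_pos p0 q0]
      _ = _ := by ring
  have h2 : nrm q u ^ 2 ≤ 2 * (2 * Real.pi * ε) ^ 2 * a ^ 2 + 2 * (ε + K) ^ 2 * y ^ 2 := by
    have := pow_le_pow_left₀ (nrm_nonneg q u) h1 2
    nlinarith [sq_nonneg (2 * Real.pi * ε * a - (ε + K) * y)]
  have h3 : M * (2 * (2 * Real.pi * ε) ^ 2) ≤ 1 := by
    have : 2 * Real.pi * ε = 1 / (2 * (M + 1)) := by rw [hε]; field_simp; ring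
    rw [this, div_pow, one_pow, mul_div_assoc', mul_div_assoc', div_le_one (by positivity)]
    nlinarith
  have h4 := mul_le_mul_of_nonneg_left h2 hM
  have h5 := mul_le_mul_of_nonneg_right h3 (sq_nonneg a)
  linarith

lemma mu_zero (hp : 2 < p) (hpq : p < q) : mu p q 0 = 0 :=
  le_antisymm (mu_le_self hp hpq le_rfl) (mu_nonneg hp hpq le_rfl)

/-- The optimal constant is nondecreasing, concave and unbounded, hence increasing. -/
lemma mu_strictMonoOn (hp : 2 < p) (hpq : p < q) : StrictMonoOn (mu p q) (Set.Ici 0) := by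
  intro l hl l' hl' h
  rw [Set.mem_Ici] at hl hl'
  refine (mu_mono hp hpq hl h.le).lt_of_ne fun he => ?_
  obtain ⟨L, hL, hLm⟩ := mu_unbounded hp hpq
    (by linarith [mu_nonneg hp hpq hl] : 0 ≤ mu p q l + 1)
  have hL' : l' < L := by
    by_contra hcon
    have := mu_mono hp hpq hL (not_lt.1 hcon)
    linarith
  have hd : 0 < L - l := by linarith
  have hc := mu_concave hp hpq hl hL (a := (L - l') / (L - l)) (b := (l' - l) / (L - l))
    (div_nonneg (by linarith) hd.le) (div_nonneg (by linarith) hd.le) (by field_simp; ring)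
  have e : (L - l') / (L - l) * l + (l' - l) / (L - l) * L = l' := by field_simp; ring
  rw [e, ← he] at hc
  have hb : 0 < (l' - l) / (L - l) := div_pos (by linarith) hd
  have e2 : (L - l') / (L - l) = 1 - (l' - l) / (L - l) := by field_simp; ring
  rw [e2] at hc
  have := mul_le_mul_of_nonneg_left hLm hb.le
  linarith

theorem mu_bijOn (hp : 2 < p) (hpq : p < q) : Set.BijOn (mu p q) (Set.Ici 0) (Set.Ici 0) := by
  refine ⟨fun l hl => mu_nonneg hp hpq hl, (mu_strictMonoOn hp hpq).injOn, fun m hm => ?_⟩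
  obtain ⟨L, hL, hLm⟩ := mu_unbounded hp hpq hm
  have h := intermediate_value_Icc hL ((mu_continuousOn hp hpq).mono Set.Icc_subset_Ici_self)
  rw [mu_zero hp hpq] at h
  obtain ⟨l, hl, rfl⟩ := h ⟨hm, hLm⟩
  exact ⟨l, hl.1, rfl⟩

lemma lam_nonneg (hp : 2 < p) (hpq : p < q) {m : ℝ} (hm : 0 ≤ m) : 0 ≤ lam p q m :=
  Function.invFunOn_mem ((mu_bijOn hp hpq).surjOn hm)

lemma mu_lam (hp : 2 < p) (hpq : p < q) {m : ℝ} (hm : 0 ≤ m) : mu p q (lam p q m) = m :=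
  Function.invFunOn_eq ((mu_bijOn hp hpq).surjOn hm)

lemma lam_eq_self (hp : 2 < p) (hpq : p < q) {m : ℝ} (hm : 0 ≤ m)
    (h : m ≤ lambda1 p / (q - p)) : lam p q m = m := by
  rw [le_div_iff₀ (by linarith)] at h
  refine (mu_bijOn hp hpq).injOn (lam_nonneg hp hpq hm) hm ?_
  rw [mu_lam hp hpq hm, mu_eq_self hp hpq hm h]

/-! ### Potentials -/

lemma holderConjugate_exponents (hp : 0 < p) (hpq : p < q) :
    (q / (q - p)).HolderConjugate (q / p) := by
  have hq : 0 < q := hp.trans hpq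
  rw [Real.holderConjugate_iff]
  constructor
  · rw [lt_div_iff₀ (by linarith)]; linarith
  · field_simp; ring

variable {V u du : Circ → ℝ}

lemma memLp_rpow_of_memLp (hp : 0 < p) (hpq : p < q) (hu : MemLp u (ENNReal.ofReal q) sigma) :
    MemLp (fun x => |u x| ^ p) (ENNReal.ofReal (q / p)) sigma :=
  memLp_rpow_abs (div_pos (hp.trans hpq) hp) hp (by rwa [div_mul_cancel₀ _ hp.ne'])

lemma integrable_pot (hp : 0 < p) (hpq : p < q)
    (hV : MemLp V (ENNReal.ofReal (q / (q - p))) sigma) (hu : MemLp u (ENNReal.ofReal q) sigma) :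
    Integrable (fun x => V x * |u x| ^ p) sigma := by
  have := (holderConjugate_exponents hp hpq).ennrealOfReal
  exact hV.integrable_mul (memLp_rpow_of_memLp hp hpq hu)

lemma pot_le (hp : 0 < p) (hpq : p < q)
    (hV : MemLp V (ENNReal.ofReal (q / (q - p))) sigma) (hu : MemLp u (ENNReal.ofReal q) sigma) :
    pot p V u ≤ nrm (q / (q - p)) V * nrm q u ^ p := by
  have h1 := integral_abs_mul_le (holderConjugate_exponents hp hpq) hV
    (memLp_rpow_of_memLp hp hpq hu)
  rw [nrm_rpow_abs (div_pos (hp.trans hpq) hp) hp, div_mul_cancel₀ _ hp.ne'] at h1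
  refine le_trans ?_ h1
  have hi := integrable_pot hp hpq hV hu
  have ha : Integrable (fun x => |V x| * |(|u x| ^ p)|) sigma :=
    hi.abs.congr (.of_forall fun x => abs_mul _ _)
  refine integral_mono hi ha fun x => ?_
  simp only
  rw [← abs_mul]
  exact le_abs_self _

lemma rpow_two_sub_mul_rpow {x : ℝ} (hx : 0 < x) : x ^ (2 - p) * x ^ p = x ^ 2 := by
  rw [← Real.rpow_add hx, sub_add_cancel, Real.rpow_two]

/-- If the potential energy of a nonzero constant function equals its upper bound, the potential
is a nonnegative constant. -/
lemma exists_const_of_equality (hp : 2 < p) (hpq : p < q)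
    (hV : MemLp V (ENNReal.ofReal (q / (q - p))) sigma) {c : ℝ} (hc : c ≠ 0)
    (hu : u =ᵐ[sigma] fun _ => c)
    (h : pot p V u = nrm (q / (q - p)) V * nrm q u ^ p) :
    ∃ c : ℝ, 0 ≤ c ∧ V =ᵐ[sigma] fun _ => c := by
  refine ⟨_, nrm_nonneg _ _, ae_eq_const_of_integral_eq_nrm
    (holderConjugate_exponents (by linarith) hpq).lt hV ?_⟩
  have h1 : pot p V u = (∫ x, V x ∂sigma) * |c| ^ p := by
    rw [pot, ← integral_mul_const]
    refine integral_congr_ae ?_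
    filter_upwards [hu] with x hx
    rw [hx]
  rw [h1, nrm_congr hu, nrm_const (by linarith)] at h
  exact mul_right_cancel₀ (Real.rpow_pos_of_pos (abs_pos.2 hc) p).ne' h

/-- The potential energy normalized by a power of the norm of `u` is controlled by the `L^q`
norm; the junk value `0 ^ (2 - p) = 0` is the intended one when `u = 0`. -/
lemma normalized_pot_le (hp : 2 < p) (hpq : p < q)
    (hV : MemLp V (ENNReal.ofReal (q / (q - p))) sigma) (hu : MemLp u (ENNReal.ofReal q) sigma) :
    nrm q u ^ (2 - p) * pot p V u ≤ nrm (q / (q - p)) V * nrm q u ^ 2 := by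
  rcases (nrm_nonneg q u).eq_or_lt with h0 | h0
  · rw [← h0, Real.zero_rpow (by linarith)]
    simp
  · have h1 := mul_le_mul_of_nonneg_left (pot_le (by linarith) hpq hV hu)
      (Real.rpow_nonneg h0.le (2 - p))
    rw [← rpow_two_sub_mul_rpow (p := p) h0]
    linarith

lemma pot_pos_part_rpow_le (hp : 2 < p) (hpq : p < q)
    (hV : MemLp V (ENNReal.ofReal (q / (q - p))) sigma) (hu : MemLp u (ENNReal.ofReal q) sigma) :
    (max (pot p V u) 0) ^ (2 / p) ≤ nrm (q / (q - p)) V ^ (2 / p) * nrm q u ^ 2 := by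
  have p0 : 0 < p := by linarith
  have hn := Real.rpow_nonneg (nrm_nonneg q u) p
  have h1 : max (pot p V u) 0 ≤ nrm (q / (q - p)) V * nrm q u ^ p :=
    max_le (pot_le p0 hpq hV hu) (mul_nonneg (nrm_nonneg _ _) hn)
  have h2 := Real.rpow_le_rpow (le_max_right _ _) h1 (by positivity : 0 ≤ 2 / p)
  rwa [Real.mul_rpow (nrm_nonneg _ _) hn, ← Real.rpow_mul (nrm_nonneg _ _),
    mul_div_cancel₀ _ p0.ne', Real.rpow_two] at h2

lemma nrm_const_potential (hp : 0 < p) (hpq : p < q) {c : ℝ} (hc : 0 ≤ c)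
    (hV : V =ᵐ[sigma] fun _ => c) : nrm (q / (q - p)) V = c := by
  rw [nrm_congr hV, nrm_const (div_pos (by linarith) (by linarith)), abs_of_nonneg hc]

lemma pot_const_one {c : ℝ} (hV : V =ᵐ[sigma] fun _ => c) :
    pot p V (fun _ => 1) = c := by
  have : pot p V (fun _ => 1) = ∫ _, c ∂sigma := by
    refine integral_congr_ae ?_
    filter_upwards [hV] with x hx
    simp [hx]
  simp [this]

end

end KLT

theorem corollary1 (p q : ℝ) (hp : 2 < p) (hpq : p < q) :
    -- the function `λ` is well defined, as the inverse of the bijection `μ`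
    Set.BijOn (KLT.mu p q) (Set.Ici 0) (Set.Ici 0) ∧
    -- the integrals are finite
    (∀ V : KLT.Circ → ℝ, MemLp V (ENNReal.ofReal (q / (q - p))) KLT.sigma →
      ∀ u du : KLT.Circ → ℝ, KLT.IsW1p p u du →
        MemLp u (ENNReal.ofReal q) KLT.sigma ∧
        Integrable (fun x => V x * |u x| ^ p) KLT.sigma) ∧
    -- the estimate, with the potential term normalized by a power of the norm of `u`
    (∀ V : KLT.Circ → ℝ, MemLp V (ENNReal.ofReal (q / (q - p))) KLT.sigma →
      (∀ u du : KLT.Circ → ℝ, KLT.IsW1p p u du →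
        KLT.nrm p du ^ 2 - KLT.nrm q u ^ (2 - p) * KLT.pot p V u ≥
          - KLT.lam p q (KLT.nrm (q / (q - p)) V) * KLT.nrm p u ^ 2) ∧
      (KLT.nrm (q / (q - p)) V ≤ KLT.lambda1 p / (q - p) →
        KLT.lam p q (KLT.nrm (q / (q - p)) V) = KLT.nrm (q / (q - p)) V ∧
        ((∃ u du : KLT.Circ → ℝ, KLT.IsW1p p u du ∧ KLT.NonZero u ∧
            KLT.nrm p du ^ 2 - KLT.nrm q u ^ (2 - p) * KLT.pot p V u =
              - KLT.lam p q (KLT.nrm (q / (q - p)) V) * KLT.nrm p u ^ 2) ↔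
          ∃ c : ℝ, 0 ≤ c ∧ V =ᵐ[KLT.sigma] fun _ => c))) ∧
    -- the estimate, with the potential term raised to the power `2 / p`
    (∀ V : KLT.Circ → ℝ, MemLp V (ENNReal.ofReal (q / (q - p))) KLT.sigma →
      (∀ u du : KLT.Circ → ℝ, KLT.IsW1p p u du →
        KLT.nrm p du ^ 2 - (max (KLT.pot p V u) 0) ^ (2 / p) ≥
          - KLT.lam p q (KLT.nrm (q / (q - p)) V ^ (2 / p)) * KLT.nrm p u ^ 2) ∧
      (KLT.nrm (q / (q - p)) V ^ (2 / p) ≤ KLT.lambda1 p / (q - p) →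
        KLT.lam p q (KLT.nrm (q / (q - p)) V ^ (2 / p)) = KLT.nrm (q / (q - p)) V ^ (2 / p) ∧
        ((∃ u du : KLT.Circ → ℝ, KLT.IsW1p p u du ∧ KLT.NonZero u ∧
            KLT.nrm p du ^ 2 - (max (KLT.pot p V u) 0) ^ (2 / p) =
              - KLT.lam p q (KLT.nrm (q / (q - p)) V ^ (2 / p)) * KLT.nrm p u ^ 2) ↔
          ∃ c : ℝ, 0 ≤ c ∧ V =ᵐ[KLT.sigma] fun _ => c))) := by
  have p0 : 0 < p := by linarith
  have q0 : 0 < q := by linarith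
  have hqp : 0 < q - p := by linarith
  have hr : 0 < q / (q - p) := div_pos q0 hqp
  refine ⟨KLT.mu_bijOn hp hpq, fun V hV u du hu =>
    ⟨hu.memLp_of_two_le hp.le _, KLT.integrable_pot p0 hpq hV (hu.memLp_of_two_le hp.le _)⟩,
    fun V hV => ?_, fun V hV => ?_⟩
  · have hm : 0 ≤ KLT.nrm (q / (q - p)) V := KLT.nrm_nonneg _ _
    refine ⟨fun u du hu => ?_, fun hsmall => ?_⟩
    · have h1 := KLT.mu_mul_le hp hpq (KLT.lam_nonneg hp hpq hm) hu
      rw [KLT.mu_lam hp hpq hm] at h1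
      have h2 := KLT.normalized_pot_le hp hpq hV (hu.memLp_of_two_le hp.le _)
      linarith
    have hlam := KLT.lam_eq_self hp hpq hm hsmall
    refine ⟨hlam, ?_, ?_⟩
    · rintro ⟨u, du, hu, hnz, heq⟩
      have hu' := hu.memLp_of_two_le hp.le (ENNReal.ofReal q)
      have hsmall' := (le_div_iff₀ hqp).1 hsmall
      have hmu := KLT.mu_eq_self hp hpq hm hsmall'
      have h1 := KLT.mu_mul_le hp hpq hm hu
      have h2 := KLT.normalized_pot_le hp hpq hV hu'
      rw [hlam] at heq
      rw [hmu] at h1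
      obtain ⟨-, c, hc, huc⟩ := KLT.rigidity hp hpq hm hsmall' hu hnz (by rw [hmu]; linarith)
      have hnq : 0 < KLT.nrm q u := KLT.nrm_pos q0 hu' hnz
      refine KLT.exists_const_of_equality hp hpq hV hc huc ?_
      apply mul_left_cancel₀ (Real.rpow_pos_of_pos hnq (2 - p)).ne'
      rw [mul_left_comm, KLT.rpow_two_sub_mul_rpow hnq]
      linarith
    · rintro ⟨c, hc, hVc⟩
      refine ⟨_, _, KLT.isW1p_const p 1, KLT.nonZero_const one_ne_zero, ?_⟩
      rw [hlam, KLT.pot_const_one hVc, KLT.nrm_const_potential p0 hpq hc hVc, KLT.nrm_const p0,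
        KLT.nrm_const p0, KLT.nrm_const q0]
      simp
  · have hm : 0 ≤ KLT.nrm (q / (q - p)) V ^ (2 / p) := Real.rpow_nonneg (KLT.nrm_nonneg _ _) _
    refine ⟨fun u du hu => ?_, fun hsmall => ?_⟩
    · have h1 := KLT.mu_mul_le hp hpq (KLT.lam_nonneg hp hpq hm) hu
      rw [KLT.mu_lam hp hpq hm] at h1
      have h2 := KLT.pot_pos_part_rpow_le hp hpq hV (hu.memLp_of_two_le hp.le _)
      linarith
    have hlam := KLT.lam_eq_self hp hpq hm hsmall
    refine ⟨hlam, ?_, ?_⟩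
    · rintro ⟨u, du, hu, hnz, heq⟩
      rcases (KLT.nrm_nonneg (q / (q - p)) V).eq_or_lt with hV0 | hV0
      · exact ⟨0, le_rfl, (KLT.nrm_eq_zero_iff hr hV).1 hV0.symm⟩
      have hu' := hu.memLp_of_two_le hp.le (ENNReal.ofReal q)
      have hsmall' := (le_div_iff₀ hqp).1 hsmall
      have hmu := KLT.mu_eq_self hp hpq hm hsmall'
      have h1 := KLT.mu_mul_le hp hpq hm hu
      have h2 := KLT.pot_pos_part_rpow_le hp hpq hV hu'
      rw [hlam] at heq
      rw [hmu] at h1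
      obtain ⟨-, c, hc, huc⟩ := KLT.rigidity hp hpq hm hsmall' hu hnz (by rw [hmu]; linarith)
      have hnq : 0 < KLT.nrm q u := KLT.nrm_pos q0 hu' hnz
      refine KLT.exists_const_of_equality hp hpq hV hc huc ?_
      have hn := Real.rpow_pos_of_pos hnq p
      have h3 : (max (KLT.pot p V u) 0) ^ (2 / p) =
          (KLT.nrm (q / (q - p)) V * KLT.nrm q u ^ p) ^ (2 / p) := by
        rw [Real.mul_rpow hV0.le hn.le, ← Real.rpow_mul hnq.le, mul_div_cancel₀ _ p0.ne',
          Real.rpow_two]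
        linarith
      have h4 := (Real.rpow_left_inj (le_max_right _ _) (mul_nonneg hV0.le hn.le)
        (by positivity : 2 / p ≠ 0)).1 h3
      have h5 : 0 < max (KLT.pot p V u) 0 := by rw [h4]; exact mul_pos hV0 hn
      rw [max_eq_left_of_lt (by simpa using h5)] at h4
      exact h4
    · rintro ⟨c, hc, hVc⟩
      refine ⟨_, _, KLT.isW1p_const p 1, KLT.nonZero_const one_ne_zero, ?_⟩
      rw [hlam, KLT.pot_const_one hVc, KLT.nrm_const_potential p0 hpq hc hVc, KLT.nrm_const p0,
        KLT.nrm_const p0, max_eq_left hc]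
      simp
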